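/- For a real number $p$, an integer $r\ge 2$ and a real number $\epsilon$, say that a (finite, simple) graph $G$ on $n$ vertices satisfies $\mathcal{P}^*_{r,p}(\epsilon)$ if for every subset $S\subseteq V(G)$ the number of labeled copies of the complete graph $K_r$ in the induced subgraph $G[S]$ (that is, of injective graph homomorphisms $K_r\to G[S]$) differs from $p^{\binom r2}|S|^r$ by at most $\epsilon n^r$. In particular, $\mathcal{P}^*_{2,p}(\epsilon)$ says that twice the number of edges of $G[S]$ differs from $p|S|^2$ by at most $\epsilon n^2$, for every $S\subseteq V(G)$. Theorem. For every natural number $r\ge 3$ there is a constant $c(r)>0$ such that, for all real $p,\epsilon$ with $0<p<1$ and $0<\epsilon<1$, there is an $N=N(r,p,\epsilon)$ such that, for every $n\ge N$, every $n$-vertex graph $G$ that satisfies $\mathcal{P}^*_{r,p}(\delta)$ with $\delta=c(r)\,p^{2r^2}\epsilon$ also satisfies $\mathcal{P}^*_{2,p}(\epsilon)$. -/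

import Mathlib

/-- The number of labelled copies of `H` in the subgraph of `G` induced by `S`, that is, of
injective graph homomorphisms from `H` to `G[S]`. -/
noncomputable def labelledCopiesIn {W V : Type*} [Fintype W] [Fintype V]
    (H : SimpleGraph W) (G : SimpleGraph V) (S : Finset V) : ℕ :=
  (G.induce (S : Set V)).labelledCopyCount H

/-- The hereditary property `P*_{H,p}(ε)` of a graph `G` on `n` vertices: for every set `S` of
vertices, the number of labelled copies of `H` in `G[S]` is within `ε n ^ v(H)` of
`p ^ e(H) * |S| ^ v(H)`. -/
def HereditaryCount {W V : Type*} [Fintype W] [Fintype V]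
    (H : SimpleGraph W) (p ε : ℝ) (G : SimpleGraph V) : Prop :=
  ∀ S : Finset V,
    |(labelledCopiesIn H G S : ℝ) - p ^ H.edgeSet.ncard * (S.card : ℝ) ^ Fintype.card W| ≤
      ε * (Fintype.card V : ℝ) ^ Fintype.card W

/-- The property `P*_{r,p}(ε)`, which is `P*_{H,p}(ε)` for the complete graph `H = K_r`. -/
def HereditaryCliqueCount {V : Type*} [Fintype V]
    (r : ℕ) (p ε : ℝ) (G : SimpleGraph V) : Prop :=
  HereditaryCount (SimpleGraph.completeGraph (Fin r)) p ε G

/-!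
Write `n` for the number of vertices, `e = r (r - 1) / 2`, and for weight functions `f i` with
values in `[0, 1 / n]` let `T f` be the weighted number of labelled copies of `K_r`. Only the case
where all weights are equal to the same indicator is controlled by the hypothesis. Since injective
tuples are counted by a multi-affine function of the weights, the bound passes from indicators to
all functions with values in `[0, 1]` (this is where `n` has to be large, as the tuples with
repeated entries are discarded), and polarization then makes the `f i` independent of one another:
`T f` is within `O(δ)` of `p ^ e` times the product of the total weights
(`abs_cliqueForm_sub_le`).

The weights may absorb edges to vertices that are held fixed. Hence adding or removing the edges
of a `K_r` on `r` vertices of any larger pattern multiplies its density by `p ^ e` or `p ^ (-e)`,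
as long as no two of these vertices are joined by further edges of the pattern. In the pattern
formed by a clique of order `r - 2` joined to a four-cycle `xydc`, removing the clique through `x`
and `y`, moving the remaining core away with the help of two new vertices, and cutting off the
pendant edges `xc` and `yd`, one sees that the density of the pattern is about a constant times
`e(x, c) * e(y, d)`. By the symmetry of the four-cycle it is also about the same constant times
`e(x, y) * e(c, d)`. So the edge form has nearly rank one: with the normalized degree `d` and the
edge density `m`, the product `m * e(f, g)` is close to `(∑ f d) * (∑ g d)`
(`abs_edgeForm_exchange_le`, `abs_edgeForm_rank_one_le`).

Replacing the edges of `K_r` one by one (`abs_patternForm_sub_le`) now gives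
`m ^ e * T f ≈ ∏ i, ∑ f i * d ^ (r - 1)`. As `T f` is proportional to the product of the total
weights, `d ^ (r - 1)` is nearly constant, and the value of the constant shows that `d` is close to
`q = √(p m)` in the mean (`sum_abs_degree_sub_le`). Averaging, `m` is close to `√(p m)`, hence to
`p`, and the edge form is close to `p`. All these steps are linear in `δ`. To lose no more than the
factor `p ^ (-4 * e)` one needs a lower bound for `m` of the order of `p` itself; it comes from
counting cliques among the vertices of degree at most `2 * m` (`div_sixteen_le_density`).
-/

open Finset

namespace HereditaryQuasirandom

/-! ### The weighted clique count -/

section WeightedCliques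

variable {V : Type*} {r : ℕ}

/-- The pairs `i < j` of indices, that is, the edges of the complete graph on `Fin r`. -/
def pairs (r : ℕ) : Finset (Fin r × Fin r) := univ.filter fun e => e.1 < e.2

/-- The product of the values of a symmetric kernel `W` over all pairs of entries of `x`. For the
adjacency kernel of a graph it is the indicator of the event that `x` spans a clique. -/
def cliqueKernel (W : V → V → ℝ) (x : Fin r → V) : ℝ := ∏ e ∈ pairs r, W (x e.1) (x e.2)

/-- The weighted count of labelled copies of `K_r`, in which the `i`-th vertex carries the
weight `f i`. It is multilinear in `f`. -/
def cliqueForm [Fintype V] (W : V → V → ℝ) (f : Fin r → V → ℝ) : ℝ :=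
  ∑ x : Fin r → V, (∏ i, f i (x i)) * cliqueKernel W x

open Classical in
/-- The adjacency relation of `G` as a real kernel with values `0` and `1`. -/
noncomputable def adjKernel (G : SimpleGraph V) (x y : V) : ℝ := if G.Adj x y then 1 else 0

lemma adjKernel_nonneg (G : SimpleGraph V) (x y : V) : 0 ≤ adjKernel G x y := by
  unfold adjKernel; split_ifs <;> norm_num

lemma adjKernel_le_one (G : SimpleGraph V) (x y : V) : adjKernel G x y ≤ 1 := by
  unfold adjKernel; split_ifs <;> norm_num

open Classical in
lemma cliqueKernel_adjKernel (G : SimpleGraph V) (x : Fin r → V) :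
    cliqueKernel (adjKernel G) x = if ∀ i j, i ≠ j → G.Adj (x i) (x j) then 1 else 0 := by
  unfold cliqueKernel adjKernel pairs
  rw [Finset.prod_ite_zero]
  simp only [prod_const_one]
  congr 1
  simp only [mem_filter, mem_univ, true_and, Prod.forall, eq_iff_iff]
  refine ⟨fun h i j hij => ?_, fun h i j hij => h i j hij.ne⟩
  rcases lt_or_gt_of_ne hij with h1 | h1
  · exact h i j h1
  · exact (h j i h1).symm

lemma cliqueKernel_comp_perm (G : SimpleGraph V) (x : Fin r → V) (σ : Equiv.Perm (Fin r)) :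
    cliqueKernel (adjKernel G) (x ∘ σ) = cliqueKernel (adjKernel G) x := by
  classical
  rw [cliqueKernel_adjKernel, cliqueKernel_adjKernel]
  congr 1
  simp only [Function.comp, eq_iff_iff]
  refine ⟨fun h i j hij => ?_, fun h i j hij => h _ _ (σ.injective.ne hij)⟩
  simpa using h (σ.symm i) (σ.symm j) (σ.symm.injective.ne hij)

lemma cliqueKernel_eq_zero_of_not_injective (G : SimpleGraph V) (x : Fin r → V)
    (hx : ¬ Function.Injective x) : cliqueKernel (adjKernel G) x = 0 := by
  classical
  rw [cliqueKernel_adjKernel, if_neg]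
  intro h
  apply hx
  intro i j hij
  by_contra hne
  exact G.loopless.irrefl (x j) (by simpa [hij] using h i j hne)

lemma two_mul_card_pairs (r : ℕ) : 2 * (pairs r).card = r * (r - 1) := by
  have h1 : (univ.filter fun e : Fin r × Fin r => e.1 < e.2).card
      = (univ.filter fun e : Fin r × Fin r => e.2 < e.1).card := by
    refine Finset.card_bij' (fun e _ => e.swap) (fun e _ => e.swap) ?_ ?_ ?_ ?_ <;> simp
  have h2 : (univ.filter fun e : Fin r × Fin r => e.1 ≠ e.2).card = r * (r - 1) := by
    have := Finset.offDiag_card (univ : Finset (Fin r))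
    rw [card_univ, Fintype.card_fin] at this
    rw [Nat.mul_sub_one, ← this]
    congr 1
    ext e; simp [Finset.mem_offDiag]
  have h3 : (univ.filter fun e : Fin r × Fin r => e.1 ≠ e.2)
      = (univ.filter fun e : Fin r × Fin r => e.1 < e.2) ∪
        (univ.filter fun e : Fin r × Fin r => e.2 < e.1) := by
    ext e; simp [lt_or_lt_iff_ne]
  rw [h3, card_union_of_disjoint, ← h1] at h2
  · unfold pairs; omega
  · rw [Finset.disjoint_filter]; intro e _ h; exact not_lt.mpr h.le

lemma card_pairs (r : ℕ) : (pairs r).card = r.choose 2 := by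
  have := two_mul_card_pairs r
  rw [Nat.choose_two_right]; omega

lemma ncard_edgeSet_completeGraph (r : ℕ) :
    (SimpleGraph.completeGraph (Fin r)).edgeSet.ncard = (pairs r).card := by
  classical
  rw [card_pairs, ← SimpleGraph.coe_edgeFinset, Set.ncard_coe_finset]
  simpa using SimpleGraph.card_edgeFinset_top_eq_card_choose_two (V := Fin r)

variable [Fintype V]

/-- Adjacent vertices are distinct, so every homomorphism from a complete graph is injective and
the labelled copies of `K_r` are counted by the clique form without any correction. -/
lemma labelledCopiesIn_completeGraph (G : SimpleGraph V) (S : Finset V) :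
    (labelledCopiesIn (SimpleGraph.completeGraph (Fin r)) G S : ℝ)
      = cliqueForm (adjKernel G) fun (_ : Fin r) => (S : Set V).indicator 1 := by
  classical
  have e : SimpleGraph.Copy (SimpleGraph.completeGraph (Fin r)) (G.induce (S : Set V)) ≃
      {x : Fin r → V // (∀ i, x i ∈ S) ∧ ∀ i j, i ≠ j → G.Adj (x i) (x j)} :=
    { toFun := fun c => ⟨fun i => (c.toHom i : V), fun i => by simp,
        fun i j hij => by
          have : (G.induce (S : Set V)).Adj (c.toHom i) (c.toHom j) := c.toHom.map_adj hij
          simpa using this⟩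
      invFun := fun x => ⟨⟨fun i => ⟨x.1 i, by simpa using x.2.1 i⟩, by
          intro i j hij
          simpa using x.2.2 i j hij⟩, by
          intro i j hij
          by_contra hne
          have h1 := x.2.2 i j hne
          have h2 : x.1 i = x.1 j := by simpa using hij
          rw [h2] at h1
          exact G.loopless.irrefl _ h1⟩
      left_inv := fun c => by rfl
      right_inv := fun x => by rfl }
  have hcard : labelledCopiesIn (SimpleGraph.completeGraph (Fin r)) G S
      = Nat.card (SimpleGraph.Copy (SimpleGraph.completeGraph (Fin r))
          (G.induce (S : Set V))) := by
    unfold labelledCopiesIn SimpleGraph.labelledCopyCount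
    exact Fintype.card_eq_nat_card
  rw [hcard, Nat.card_congr e, Nat.card_eq_fintype_card, Fintype.card_subtype, cliqueForm]
  simp_rw [cliqueKernel_adjKernel, Set.indicator_apply, Finset.prod_ite_zero]
  rw [Finset.card_filter]
  push_cast
  refine Finset.sum_congr rfl fun x _ => ?_
  by_cases h1 : ∀ i, x i ∈ S <;> by_cases h2 : ∀ i j, i ≠ j → G.Adj (x i) (x j) <;> simp [h1, h2]

/-! ### From vertex sets to vertex weights -/

/-- Replacing the weight of one vertex is an affine operation when only injective tuples are
counted, since such a tuple contains every vertex at most once. -/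
lemma sum_injective_update_affine [DecidableEq V] (k : (Fin r → V) → ℝ)
    (hk : ∀ x, ¬ Function.Injective x → k x = 0) (f : V → ℝ) (v : V) (t : ℝ) :
    ∑ x : Fin r → V, k x * ∏ i, Function.update f v t (x i)
      = (1 - t) * (∑ x : Fin r → V, k x * ∏ i, Function.update f v 0 (x i))
        + t * (∑ x : Fin r → V, k x * ∏ i, Function.update f v 1 (x i)) := by
  rw [mul_sum, mul_sum, ← sum_add_distrib]
  refine sum_congr rfl fun x _ => ?_
  by_cases hx : Function.Injective x
  · by_cases hv : ∃ i, x i = v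
    · obtain ⟨i, hi⟩ := hv
      have key : ∀ s : ℝ, ∏ j, Function.update f v s (x j) = s * ∏ j ∈ univ.erase i, f (x j) := by
        intro s
        rw [← mul_prod_erase univ _ (mem_univ i)]
        congr 1
        · simp [hi]
        · refine prod_congr rfl fun j hj => ?_
          rw [Function.update_of_ne]
          rw [← hi]
          exact hx.ne (ne_of_mem_erase hj)
      rw [key, key, key]; ring
    · push Not at hv
      have key : ∀ s : ℝ, ∏ j, Function.update f v s (x j) = ∏ j, f (x j) := fun s =>
        prod_congr rfl fun j _ => Function.update_of_ne (hv j) _ _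
      rw [key, key, key]; ring
  · simp [hk x hx]

/-- A multi-affine function on the cube `[0, 1] ^ V` attains its extreme values at the vertices,
which are the indicators of sets. -/
lemma abs_sum_injective_le_of_sets (k : (Fin r → V) → ℝ)
    (hk : ∀ x, ¬ Function.Injective x → k x = 0) (B : ℝ)
    (hB : ∀ S : Finset V, |∑ x : Fin r → V, k x * ∏ i, (S : Set V).indicator 1 (x i)| ≤ B)
    (f : V → ℝ) (hf : ∀ v, 0 ≤ f v ∧ f v ≤ 1) :
    |∑ x : Fin r → V, k x * ∏ i, f (x i)| ≤ B := by
  classical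
  have main : ∀ U : Finset V, ∀ f : V → ℝ, (∀ v, 0 ≤ f v ∧ f v ≤ 1) →
      (∀ v, v ∉ U → f v = 0 ∨ f v = 1) → |∑ x : Fin r → V, k x * ∏ i, f (x i)| ≤ B := by
    intro U
    induction U using Finset.induction_on with
    | empty =>
      intro f _ h
      have : f = ((univ.filter fun v => f v = 1 : Finset V) : Set V).indicator 1 := by
        ext v
        rcases h v (by simp) with h0 | h0 <;> simp [h0]
      rw [this]
      exact hB _
    | insert v U hv ih =>
      intro f hf h
      have hupd : ∀ s : ℝ, (s = 0 ∨ s = 1) →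
          |∑ x : Fin r → V, k x * ∏ i, Function.update f v s (x i)| ≤ B := by
        intro s hs
        apply ih
        · intro u
          by_cases hu : u = v
          · subst hu; rcases hs with rfl | rfl <;> simp
          · rw [Function.update_of_ne hu]; exact hf u
        · intro u hu
          by_cases huv : u = v
          · subst huv; simpa using hs
          · rw [Function.update_of_ne huv]; exact h u (by simp [huv, hu])
      have h0 := hupd 0 (Or.inl rfl)
      have h1 := hupd 1 (Or.inr rfl)
      have := sum_injective_update_affine k hk f v (f v)
      rw [Function.update_eq_self] at this
      rw [this]
      obtain ⟨ha, hb⟩ := hf v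
      rw [abs_le] at h0 h1 ⊢
      constructor <;> nlinarith
  exact main univ f hf (by simp)

/-- Inclusion-exclusion for the permanent: only the surjective choices `s` of columns survive. -/
lemma sum_neg_one_pow_mul_prod_sum (A : Fin r → Fin r → ℝ) :
    ∑ I : Finset (Fin r), (-1) ^ I.card * ∏ i, ∑ j ∈ I, A i j
      = (-1) ^ r * ∑ s : Fin r → Fin r with Function.Surjective s, ∏ i, A i (s i) := by
  classical
  have h1 : ∀ I : Finset (Fin r), ∏ i, ∑ j ∈ I, A i j
      = ∑ s : Fin r → Fin r, (∏ j ∈ Iᶜ, if j ∈ Set.range s then (0 : ℝ) else 1)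
          * ∏ i, A i (s i) := by
    intro I
    have : ∀ i, ∑ j ∈ I, A i j = ∑ j, if j ∈ I then A i j else 0 := by
      intro i; simp
    simp_rw [this]
    rw [Finset.prod_univ_sum]
    rw [Fintype.piFinset_univ]
    refine sum_congr rfl fun s _ => ?_
    by_cases hs : ∀ i, s i ∈ I
    · rw [prod_eq_one (s := Iᶜ), one_mul]
      · exact prod_congr rfl fun i _ => by simp [hs i]
      · intro j hj
        rw [if_neg]
        rintro ⟨i, rfl⟩
        exact (mem_compl.1 hj) (hs i)
    · push Not at hs
      obtain ⟨i, hi⟩ := hs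
      rw [prod_eq_zero (mem_univ i) (by simp [hi]),
        prod_eq_zero (s := Iᶜ) (mem_compl.2 hi) (by simp), zero_mul]
  simp_rw [h1, mul_sum, sum_filter]
  rw [sum_comm]
  refine sum_congr rfl fun s _ => ?_
  simp_rw [← mul_assoc]
  rw [← sum_mul]
  have h2 : ∑ I : Finset (Fin r), (-1 : ℝ) ^ I.card *
      (∏ j ∈ Iᶜ, if j ∈ Set.range s then (0 : ℝ) else 1)
        = ∏ j : Fin r, ((-1 : ℝ) + if j ∈ Set.range s then (0 : ℝ) else 1) := by
    rw [Finset.prod_add, powerset_univ]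
    refine sum_congr rfl fun I _ => ?_
    rw [prod_const, compl_eq_univ_sdiff]
  rw [h2]
  by_cases hs : Function.Surjective s
  · rw [if_pos hs]
    congr 1
    simp [hs.range_eq]
  · rw [if_neg hs]
    obtain ⟨j, hj⟩ := not_forall.1 hs
    rw [prod_eq_zero (mem_univ j), zero_mul]
    rw [if_neg (by simpa using hj)]
    norm_num

/-- Polarization: a symmetric multilinear form that is bounded on the diagonal is bounded. -/
lemma abs_sum_prod_le_of_diagonal (k : (Fin r → V) → ℝ)
    (hk : ∀ (x : Fin r → V) (σ : Equiv.Perm (Fin r)), k (x ∘ σ) = k x) (hr : 0 < r)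
    (B : ℝ) (hB : ∀ f : V → ℝ, (∀ v, 0 ≤ f v ∧ f v ≤ 1) →
      |∑ x : Fin r → V, k x * ∏ i, f (x i)| ≤ B)
    (f : Fin r → V → ℝ) (hf : ∀ i v, 0 ≤ f i v ∧ f i v ≤ 1) :
    |∑ x : Fin r → V, k x * ∏ i, f i (x i)| ≤ (2 * r) ^ r * B := by
  classical
  set Φ := ∑ x : Fin r → V, k x * ∏ i, f i (x i) with hΦ
  have hr0 : (0 : ℝ) < r := by exact_mod_cast hr
  have hB0 : 0 ≤ B := (abs_nonneg _).trans (hB (fun _ => 0) (by simp))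
  have hperm : ∀ s : Fin r → Fin r, Function.Surjective s →
      ∑ x : Fin r → V, k x * ∏ i, f (s i) (x i) = Φ := by
    intro s hs
    let σ : Equiv.Perm (Fin r) := Equiv.ofBijective s hs.bijective_of_finite
    rw [hΦ, ← (Equiv.arrowCongr σ.symm (Equiv.refl V)).sum_comp]
    refine sum_congr rfl fun x _ => ?_
    have h1 : (Equiv.arrowCongr σ.symm (Equiv.refl V)) x = x ∘ σ := by ext; simp
    rw [h1, hk]
    congr 1
    exact Equiv.prod_comp σ fun i => f i (x i)
  have hsum : ∑ I : Finset (Fin r), (-1 : ℝ) ^ I.card *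
        ∑ x : Fin r → V, k x * ∏ i, ∑ j ∈ I, f j (x i)
      = (-1) ^ r * ((univ.filter fun s : Fin r → Fin r => Function.Surjective s).card * Φ) := by
    simp_rw [mul_sum]
    rw [sum_comm]
    have : ∀ x : Fin r → V, ∑ I : Finset (Fin r), (-1 : ℝ) ^ I.card *
        (k x * ∏ i, ∑ j ∈ I, f j (x i)) = (-1) ^ r * (k x *
          ∑ s : Fin r → Fin r with Function.Surjective s, ∏ i, f (s i) (x i)) := by
      intro x
      have h := sum_neg_one_pow_mul_prod_sum (fun i j => f j (x i))
      rw [mul_left_comm, ← h, mul_sum]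
      exact sum_congr rfl fun I _ => by ring
    simp_rw [this]
    rw [← mul_sum]
    congr 1
    simp_rw [mul_sum]
    rw [sum_comm, sum_congr rfl fun s hs => hperm s (mem_filter.1 hs).2]
    simp
  have hone : (1 : ℝ) ≤ (univ.filter fun s : Fin r → Fin r => Function.Surjective s).card := by
    have : 0 < (univ.filter fun s : Fin r → Fin r => Function.Surjective s).card :=
      card_pos.2 ⟨id, by simp [Function.surjective_id]⟩
    exact_mod_cast this
  have hbound : ∀ I : Finset (Fin r),
      |(-1 : ℝ) ^ I.card * ∑ x : Fin r → V, k x * ∏ i, ∑ j ∈ I, f j (x i)| ≤ r ^ r * B := by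
    intro I
    -- The sum of the `f j` is scaled down by `r` to bring it into the cube.
    have h1 := hB (fun v => (∑ j ∈ I, f j v) / r) (fun v => ⟨by
      exact div_nonneg (sum_nonneg fun j _ => (hf j v).1) hr0.le, by
      rw [div_le_one hr0]
      calc ∑ j ∈ I, f j v ≤ ∑ j ∈ I, 1 := sum_le_sum fun j _ => (hf j v).2
        _ ≤ r := by
          have := card_le_univ I
          simp only [Fintype.card_fin] at this
          simpa using this⟩)
    have h2 : ∑ x : Fin r → V, k x * ∏ i, (∑ j ∈ I, f j (x i)) / (r : ℝ)
        = (∑ x : Fin r → V, k x * ∏ i, ∑ j ∈ I, f j (x i)) / (r : ℝ) ^ r := by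
      rw [sum_div]
      refine sum_congr rfl fun x _ => ?_
      rw [prod_div_distrib, prod_const, card_univ, Fintype.card_fin, mul_div_assoc]
    rw [h2, abs_div, abs_of_pos (pow_pos hr0 r), div_le_iff₀ (pow_pos hr0 r)] at h1
    rw [abs_mul, abs_pow, abs_neg, abs_one, one_pow, one_mul]
    linarith
  calc |Φ| ≤ (univ.filter fun s : Fin r → Fin r => Function.Surjective s).card * |Φ| :=
        le_mul_of_one_le_left (abs_nonneg _) hone
    _ = |∑ I : Finset (Fin r), (-1 : ℝ) ^ I.card *
          ∑ x : Fin r → V, k x * ∏ i, ∑ j ∈ I, f j (x i)| := by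
        rw [hsum, abs_mul, abs_pow, abs_neg, abs_one, one_pow, one_mul, abs_mul, Nat.abs_cast]
    _ ≤ ∑ I : Finset (Fin r), (r : ℝ) ^ r * B :=
        (abs_sum_le_sum_abs _ _).trans (sum_le_sum fun I _ => hbound I)
    _ = (2 * r) ^ r * B := by
        rw [sum_const, card_univ, Fintype.card_finset, Fintype.card_fin, nsmul_eq_mul]
        push_cast; ring

open Classical in
/-- All but at most `r ^ 2 * n ^ (r - 1)` tuples are injective. -/
lemma card_not_injective_le (δ : ℝ) (hδ : 0 < δ) (hn : (r : ℝ) ^ 2 / δ ≤ Fintype.card V)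
    (hr : 0 < r) :
    ((univ.filter fun x : Fin r → V => ¬ Function.Injective x).card : ℝ)
      ≤ δ * (Fintype.card V : ℝ) ^ r := by
  set n := Fintype.card V with hn_def
  have hr0 : (0 : ℝ) < r := by exact_mod_cast hr
  have hn0 : (0 : ℝ) < n := lt_of_lt_of_le (by positivity) hn
  have hinj : (univ.filter fun x : Fin r → V => Function.Injective x).card = n.descFactorial r := by
    rw [← Fintype.card_subtype, Fintype.card_congr (Equiv.subtypeInjectiveEquivEmbedding (Fin r) V),
      Fintype.card_embedding_eq, Fintype.card_fin]
  have htot := card_filter_add_card_filter_not (s := (univ : Finset (Fin r → V)))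
    (fun x : Fin r → V => Function.Injective x)
  rw [hinj, card_univ, Fintype.card_fun, Fintype.card_fin] at htot
  have htot' : (n.descFactorial r : ℝ)
      + ((univ.filter fun x : Fin r → V => ¬ Function.Injective x).card : ℝ) = (n : ℝ) ^ r := by
    exact_mod_cast htot
  have hrn : (r : ℝ) ^ 2 / n ≤ δ := by
    rw [div_le_iff₀ hδ] at hn
    rw [div_le_iff₀ hn0]; linarith
  suffices h : (1 - (r : ℝ) ^ 2 / n) * (n : ℝ) ^ r ≤ n.descFactorial r by
    have : (r : ℝ) ^ 2 / n * (n : ℝ) ^ r ≤ δ * (n : ℝ) ^ r := by gcongr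
    linarith
  by_cases hlt : n < r
  · have : (1 : ℝ) ≤ (r : ℝ) ^ 2 / n := by
      rw [le_div_iff₀ hn0]
      have h1 : (n : ℝ) < r := by exact_mod_cast hlt
      have h2 : (1 : ℝ) ≤ r := by exact_mod_cast hr
      nlinarith
    calc (1 - (r : ℝ) ^ 2 / n) * (n : ℝ) ^ r ≤ 0 :=
          mul_nonpos_of_nonpos_of_nonneg (by linarith) (by positivity)
      _ ≤ _ := by positivity
  · push Not at hlt
    have h1 : (n + 1 - r) ^ r ≤ n.descFactorial r := Nat.pow_sub_le_descFactorial n r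
    have h2 : ((n : ℝ) - r) ^ r ≤ n.descFactorial r := by
      calc ((n : ℝ) - r) ^ r ≤ ((n + 1 - r : ℕ) : ℝ) ^ r := by
            have : (r : ℝ) ≤ n := by exact_mod_cast hlt
            apply pow_le_pow_left₀ (by linarith)
            rw [Nat.cast_sub (by omega)]; push_cast; linarith
        _ ≤ _ := by exact_mod_cast h1
    refine le_trans ?_ h2
    have hle : (r : ℝ) / n ≤ 1 := by
      rw [div_le_one hn0]; exact_mod_cast hlt
    have h3 := one_add_mul_le_pow (a := -((r : ℝ) / n)) (by linarith) r
    calc (1 - (r : ℝ) ^ 2 / n) * (n : ℝ) ^ r = (1 + r * -((r : ℝ) / n)) * (n : ℝ) ^ r := by ring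
      _ ≤ (1 + -((r : ℝ) / n)) ^ r * (n : ℝ) ^ r := by gcongr
      _ = ((n : ℝ) - r) ^ r := by rw [← mul_pow]; congr 1; field_simp; ring

/-- The hereditary clique count, which speaks of one vertex set, controls the clique form with
arbitrary weights in `[0, 1]`, which may differ from one vertex of the clique to the next. -/
theorem abs_cliqueForm_sub_le (hr : 0 < r) {p δ : ℝ} (hp0 : 0 < p) (hp1 : p < 1) (hδ : 0 < δ)
    (G : SimpleGraph V) (hn : (r : ℝ) ^ 2 / δ ≤ Fintype.card V)
    (hG : HereditaryCliqueCount r p δ G)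
    (f : Fin r → V → ℝ) (hf : ∀ i v, 0 ≤ f i v ∧ f i v ≤ 1) :
    |cliqueForm (adjKernel G) f - p ^ (pairs r).card * ∏ i, ∑ v, f i v|
      ≤ (2 * r) ^ r * (3 * δ * (Fintype.card V : ℝ) ^ r) := by
  classical
  set P := p ^ (pairs r).card with hP
  have hP0 : 0 ≤ P := by positivity
  have hP1 : P ≤ 1 := pow_le_one₀ hp0.le hp1.le
  set N := δ * (Fintype.card V : ℝ) ^ r with hN
  let k : (Fin r → V) → ℝ := fun x => cliqueKernel (adjKernel G) x - P
  have hform : ∀ f : Fin r → V → ℝ, ∑ x : Fin r → V, k x * ∏ i, f i (x i)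
      = cliqueForm (adjKernel G) f - P * ∏ i, ∑ v, f i v := by
    intro f
    rw [Finset.prod_univ_sum, Fintype.piFinset_univ, cliqueForm, mul_sum, ← sum_sub_distrib]
    exact sum_congr rfl fun x _ => by simp only [k]; ring
  let k' : (Fin r → V) → ℝ := fun x => if Function.Injective x then k x else 0
  have hdiff : ∀ f : V → ℝ, (∀ v, 0 ≤ f v ∧ f v ≤ 1) →
      |∑ x : Fin r → V, k x * ∏ i, f (x i) - ∑ x : Fin r → V, k' x * ∏ i, f (x i)| ≤ N := by
    intro f hf
    rw [← sum_sub_distrib]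
    refine (abs_sum_le_sum_abs _ _).trans ?_
    refine le_trans ?_ (card_not_injective_le δ hδ hn hr)
    rw [card_filter]
    push_cast
    refine sum_le_sum fun x _ => ?_
    by_cases hx : Function.Injective x
    · simp [k', hx]
    · have h1 : k x = -P := by simp [k, cliqueKernel_eq_zero_of_not_injective G x hx]
      have h2 : |∏ i, f (x i)| ≤ 1 := by
        rw [abs_of_nonneg (prod_nonneg fun i _ => (hf _).1)]
        exact prod_le_one (fun i _ => (hf _).1) fun i _ => (hf _).2
      simp only [k', hx, if_false, zero_mul, sub_zero, not_false_eq_true, if_true]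
      rw [abs_mul, h1, abs_neg, abs_of_nonneg hP0]
      exact mul_le_one₀ hP1 (abs_nonneg _) h2
  have hsets : ∀ S : Finset V,
      |∑ x : Fin r → V, k' x * ∏ i, (S : Set V).indicator 1 (x i)| ≤ 2 * N := by
    intro S
    have h1 := hdiff ((S : Set V).indicator 1) fun v => by
      by_cases hv : v ∈ S <;> simp [hv]
    have h2 := hG S
    rw [ncard_edgeSet_completeGraph, labelledCopiesIn_completeGraph, Fintype.card_fin] at h2
    have h3 := hform fun _ => (S : Set V).indicator 1
    have h4 : ∑ v, (S : Set V).indicator (1 : V → ℝ) v = S.card := by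
      simp [Set.indicator_apply]
    rw [h4] at h3
    simp only [prod_const, card_univ, Fintype.card_fin] at h3 h2
    rw [← h3] at h2
    rw [abs_le] at h1 h2 ⊢
    constructor <;> linarith
  have hdiag : ∀ f : V → ℝ, (∀ v, 0 ≤ f v ∧ f v ≤ 1) →
      |∑ x : Fin r → V, k x * ∏ i, f (x i)| ≤ 3 * N := by
    intro f hf
    have h1 := hdiff f hf
    have h2 := abs_sum_injective_le_of_sets k' (fun x hx => by simp [k', hx]) (2 * N) hsets f hf
    rw [abs_le] at h1 h2 ⊢
    constructor <;> linarith
  have := abs_sum_prod_le_of_diagonal k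
    (fun x σ => by simp only [k, cliqueKernel_comp_perm]) hr (3 * N) hdiag f hf
  rw [hform] at this
  rw [mul_assoc 3]
  exact this

end WeightedCliques

/-! ### Exchanging the edges of a four-cycle -/

section EdgeExchange

variable {V : Type*} {r : ℕ}

/-- The weighted count of ordered edges, that is, the clique form of `K_2`. -/
def edgeForm [Fintype V] (W : V → V → ℝ) (f g : V → ℝ) : ℝ := ∑ x, ∑ y, f x * g y * W x y

/-- The product of `W x (a i)` over all `i`: for the adjacency kernel, the indicator of the event
that `x` is adjacent to every entry of `a`. -/
def joinKernel {s : ℕ} (W : V → V → ℝ) (a : Fin s → V) (x : V) : ℝ := ∏ i, W x (a i)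

lemma joinKernel_nonneg {s : ℕ} {W : V → V → ℝ} (h0 : ∀ x y, 0 ≤ W x y) (a : Fin s → V) (x : V) :
    0 ≤ joinKernel W a x := prod_nonneg fun _ _ => h0 _ _

lemma joinKernel_le_one {s : ℕ} {W : V → V → ℝ} (h0 : ∀ x y, 0 ≤ W x y) (h1 : ∀ x y, W x y ≤ 1)
    (a : Fin s → V) (x : V) : joinKernel W a x ≤ 1 :=
  prod_le_one (fun _ _ => h0 _ _) fun _ _ => h1 _ _

lemma cliqueKernel_le_one {W : V → V → ℝ} (h0 : ∀ x y, 0 ≤ W x y) (h1 : ∀ x y, W x y ≤ 1)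
    (x : Fin r → V) : cliqueKernel W x ≤ 1 :=
  prod_le_one (fun _ _ => h0 _ _) fun _ _ => h1 _ _

lemma cliqueKernel_cons {s : ℕ} (W : V → V → ℝ) (x : V) (a : Fin s → V) :
    cliqueKernel W (Fin.cons x a : Fin (s + 1) → V) = joinKernel W a x * cliqueKernel W a := by
  have key : ∀ (n : ℕ) (z : Fin n → V),
      cliqueKernel W z = ∏ i, ∏ j, if i < j then W (z i) (z j) else 1 := by
    intro n z
    rw [cliqueKernel, pairs, prod_filter, Fintype.prod_prod_type]
  rw [key, key, Fin.prod_univ_succ, Fin.prod_univ_succ]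
  congr 1
  · simp [joinKernel, Fin.succ_pos]
  · refine prod_congr rfl fun i _ => ?_
    rw [Fin.prod_univ_succ]
    simp

variable [Fintype V]

lemma sum_tuple_succ {s : ℕ} (F : (Fin (s + 1) → V) → ℝ) :
    ∑ z, F z = ∑ x, ∑ a : Fin s → V, F (Fin.cons x a) := by
  rw [← (Fin.consEquiv fun _ : Fin (s + 1) => V).sum_comp, Fintype.sum_prod_type]
  rfl

lemma cliqueForm_cons_cons {s : ℕ} (W : V → V → ℝ) (f g : V → ℝ) (φ : Fin s → V → ℝ) :
    cliqueForm W (Fin.cons f (Fin.cons g φ) : Fin (s + 2) → V → ℝ)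
      = ∑ x, ∑ y, (∑ a : Fin s → V, (∏ i, φ i (a i)) * cliqueKernel W a * joinKernel W a x
          * joinKernel W a y) * W x y * f x * g y := by
  rw [cliqueForm, sum_tuple_succ]
  simp_rw [sum_tuple_succ, cliqueKernel_cons]
  refine sum_congr rfl fun x _ => sum_congr rfl fun y _ => ?_
  rw [sum_mul, sum_mul, sum_mul]
  refine sum_congr rfl fun a _ => ?_
  rw [Fin.prod_univ_succ, Fin.prod_univ_succ]
  have : joinKernel W (Fin.cons y a : Fin (s + 1) → V) x = W x y * joinKernel W a x := by
    simp [joinKernel, Fin.prod_univ_succ]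
  rw [this]
  simp only [Fin.cons_zero, Fin.cons_succ]
  ring

/-- The density of cliques `a` of order `s` all of whose vertices are joined to `x, y, c, d`; here
`w` is the weight of a single vertex. -/
def cliqueNbhd (s : ℕ) (w : ℝ) (W : V → V → ℝ) (x y c d : V) : ℝ :=
  ∑ a : Fin s → V, w ^ s * cliqueKernel W a * (joinKernel W a x * joinKernel W a y
    * joinKernel W a c * joinKernel W a d)

/-- The density of `s`-tuples joined to both `c` and `d`, with no condition inside the tuple. -/
def commonNbhd (s : ℕ) (w : ℝ) (W : V → V → ℝ) (c d : V) : ℝ :=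
  ∑ a : Fin s → V, w ^ s * (joinKernel W a c * joinKernel W a d)

lemma cliqueNbhd_swap_pairs (s : ℕ) (w : ℝ) (W : V → V → ℝ) (x y c d : V) :
    cliqueNbhd s w W x y c d = cliqueNbhd s w W c d x y :=
  sum_congr rfl fun a _ => by ring

lemma cliqueNbhd_swap_middle (s : ℕ) (w : ℝ) (W : V → V → ℝ) (x y c d : V) :
    cliqueNbhd s w W x y c d = cliqueNbhd s w W x c y d :=
  sum_congr rfl fun a _ => by ring

section Exchange

variable {s : ℕ} {W : V → V → ℝ} {w P δ : ℝ}

lemma commonNbhd_le_one (hw : 0 ≤ w) (hwn : Fintype.card V * w = 1) (h0 : ∀ x y, 0 ≤ W x y)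
    (h1 : ∀ x y, W x y ≤ 1) (c d : V) : commonNbhd s w W c d ≤ 1 := by
  calc commonNbhd s w W c d ≤ ∑ a : Fin s → V, w ^ s := sum_le_sum fun a _ =>
        mul_le_of_le_one_right (pow_nonneg hw s) (mul_le_one₀ (joinKernel_le_one h0 h1 a c)
          (joinKernel_nonneg h0 a d) (joinKernel_le_one h0 h1 a d))
    _ = 1 := by
        rw [sum_const, card_univ, Fintype.card_fun, Fintype.card_fin, nsmul_eq_mul, Nat.cast_pow,
          ← mul_pow, hwn, one_pow]

/-- Removing the edges of one `K_r`, two of whose vertices are `x` and `y`, while the vertices `c`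
and `d` stay fixed: the edges from `c` and `d` to the clique only change the weights. -/
lemma abs_remove_clique_le (hw : 0 ≤ w) (h0 : ∀ x y, 0 ≤ W x y) (h1 : ∀ x y, W x y ≤ 1)
    (hT : ∀ f : Fin (s + 2) → V → ℝ, (∀ i v, 0 ≤ f i v ∧ f i v ≤ w) →
      |cliqueForm W f - P * ∏ i, ∑ v, f i v| ≤ δ)
    (c d : V) (F G : V → ℝ) (hF : ∀ v, 0 ≤ F v ∧ F v ≤ w) (hG : ∀ v, 0 ≤ G v ∧ G v ≤ w) :
    |∑ x, ∑ y, cliqueNbhd s w W x y c d * W x y * F x * G y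
      - P * (commonNbhd s w W c d * (∑ v, F v) * ∑ v, G v)| ≤ δ := by
  let φ : Fin s → V → ℝ := fun _ v => w * (W c v * W d v)
  have h := hT (Fin.cons F (Fin.cons G φ)) (by
    intro i
    refine Fin.cases ?_ (fun i => ?_) i
    · simpa using hF
    · refine Fin.cases ?_ (fun i v => ?_) i
      · simpa using hG
      · simp only [Fin.cons_succ, φ]
        exact ⟨mul_nonneg hw (mul_nonneg (h0 _ _) (h0 _ _)),
          mul_le_of_le_one_right hw (mul_le_one₀ (h1 _ _) (h0 _ _) (h1 _ _))⟩)
  have hφ : ∀ a : Fin s → V, ∏ i, φ i (a i) = w ^ s * (joinKernel W a c * joinKernel W a d) := by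
    intro a
    simp only [φ, prod_mul_distrib, prod_const, card_univ, Fintype.card_fin, joinKernel]
  have hprod : ∏ i, ∑ v, φ i v = commonNbhd s w W c d := by
    rw [prod_univ_sum, Fintype.piFinset_univ]
    exact sum_congr rfl fun a _ => hφ a
  rw [cliqueForm_cons_cons, Fin.prod_univ_succ, Fin.prod_univ_succ] at h
  simp only [Fin.cons_zero, Fin.cons_succ, hprod, hφ] at h
  convert h using 3
  · refine sum_congr rfl fun x _ => sum_congr rfl fun y _ => ?_
    congr 3
    exact sum_congr rfl fun a _ => by ring
  · ring

/-- The averaged form of `abs_remove_clique_le`, in which the weights of `x` and `y` may depend on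
the remaining vertices `c` and `d`. -/
lemma abs_remove_clique_average_le (hw : 0 ≤ w) (h0 : ∀ x y, 0 ≤ W x y) (h1 : ∀ x y, W x y ≤ 1)
    (hδ : 0 ≤ δ)
    (hT : ∀ f : Fin (s + 2) → V → ℝ, (∀ i v, 0 ≤ f i v ∧ f i v ≤ w) →
      |cliqueForm W f - P * ∏ i, ∑ v, f i v| ≤ δ)
    (H : V → V → ℝ) (hH0 : ∀ c d, 0 ≤ H c d) (hH1 : ∑ c, ∑ d, H c d ≤ 1)
    (F G : V → V → V → ℝ) (hF : ∀ c d v, 0 ≤ F c d v ∧ F c d v ≤ w)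
    (hG : ∀ c d v, 0 ≤ G c d v ∧ G c d v ≤ w) :
    |∑ c, ∑ d, H c d * ∑ x, ∑ y, cliqueNbhd s w W x y c d * W x y * F c d x * G c d y
      - P * ∑ c, ∑ d, H c d * (commonNbhd s w W c d * (∑ v, F c d v) * ∑ v, G c d v)| ≤ δ := by
  rw [mul_sum, ← sum_sub_distrib]
  calc _ ≤ ∑ c, ∑ d, H c d * δ := by
        refine (abs_sum_le_sum_abs _ _).trans (sum_le_sum fun c _ => ?_)
        rw [mul_sum, ← sum_sub_distrib]
        refine (abs_sum_le_sum_abs _ _).trans (sum_le_sum fun d _ => ?_)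
        rw [mul_left_comm P, ← mul_sub, abs_mul, abs_of_nonneg (hH0 c d)]
        exact mul_le_mul_of_nonneg_left
          (abs_remove_clique_le hw h0 h1 hT c d _ _ (hF c d) (hG c d)) (hH0 c d)
    _ = (∑ c, ∑ d, H c d) * δ := by simp_rw [sum_mul]
    _ ≤ δ := mul_le_of_le_one_left hδ hH1

lemma sum_weight_le_one (hwn : Fintype.card V * w = 1) {f : V → ℝ} (hf : ∀ v, 0 ≤ f v ∧ f v ≤ w) :
    ∑ v, f v ≤ 1 := by
  calc ∑ v, f v ≤ ∑ _v : V, w := sum_le_sum fun v _ => (hf v).2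
    _ = 1 := by rw [sum_const, card_univ, nsmul_eq_mul, hwn]

lemma sum_sum_mul_le_one (hwn : Fintype.card V * w = 1) {f g : V → ℝ}
    (hf : ∀ v, 0 ≤ f v ∧ f v ≤ w) (hg : ∀ v, 0 ≤ g v ∧ g v ≤ w) {U : V → V → ℝ}
    (hU1 : ∀ x y, U x y ≤ 1) :
    ∑ x, ∑ y, f x * g y * U x y ≤ 1 := by
  calc ∑ x, ∑ y, f x * g y * U x y ≤ ∑ x, ∑ y, f x * g y :=
        sum_le_sum fun x _ => sum_le_sum fun y _ =>
          mul_le_of_le_one_right (mul_nonneg (hf x).1 (hg y).1) (hU1 x y)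
    _ = (∑ x, f x) * ∑ y, g y := by rw [sum_mul_sum]
    _ ≤ 1 := mul_le_one₀ (sum_weight_le_one hwn hf) (sum_nonneg fun v _ => (hg v).1)
        (sum_weight_le_one hwn hg)

/-- The density of the graph `K_{s+2}` without the edges inside an `s`-set of vertices. -/
def coreDensity (s : ℕ) (w : ℝ) (W : V → V → ℝ) : ℝ :=
  ∑ x, ∑ y, w * w * W x y * commonNbhd s w W x y

/-- The density of a clique of order `s` joined completely to the four-cycle with the edges
`xy`, `yd`, `dc`, `cx`, whose vertices carry the weights `f₁` (at `x`), `f₂` (at `y`), `f₃` (at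
`c`) and `f₄` (at `d`). -/
def wheelForm (s : ℕ) (w : ℝ) (W : V → V → ℝ) (f₁ f₂ f₃ f₄ : V → ℝ) : ℝ :=
  ∑ c, ∑ d, ∑ x, ∑ y, cliqueNbhd s w W x y c d * (W x y * W c d * (W x c * W y d))
    * (f₁ x * f₂ y * (f₃ c * f₄ d))

/-- Reflecting the four-cycle exchanges its two pairs of opposite edges. -/
lemma wheelForm_swap (f₁ f₂ f₃ f₄ : V → ℝ) :
    wheelForm s w W f₁ f₂ f₃ f₄ = wheelForm s w W f₁ f₃ f₂ f₄ := by
  have h : ∀ F : V → V → V → V → ℝ, ∑ c, ∑ d, ∑ x, ∑ y, F c d x y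
      = ∑ c, ∑ d, ∑ x, ∑ y, F y d x c := by
    intro F
    calc ∑ c, ∑ d, ∑ x, ∑ y, F c d x y = ∑ d, ∑ c, ∑ x, ∑ y, F c d x y := sum_comm
      _ = ∑ d, ∑ x, ∑ c, ∑ y, F c d x y := sum_congr rfl fun d _ => sum_comm
      _ = ∑ d, ∑ x, ∑ c, ∑ y, F y d x c :=
          sum_congr rfl fun d _ => sum_congr rfl fun x _ => sum_comm
      _ = ∑ d, ∑ c, ∑ x, ∑ y, F y d x c := sum_congr rfl fun d _ => sum_comm
      _ = _ := sum_comm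
  rw [wheelForm, h, wheelForm]
  refine sum_congr rfl fun c _ => sum_congr rfl fun d _ => sum_congr rfl fun x _ =>
    sum_congr rfl fun y _ => ?_
  rw [cliqueNbhd_swap_middle]
  ring

/-- The density of the wheel is nearly a constant multiple of that of the two disjoint edges
`xc` and `yd`. Removing from the wheel the clique through `x` and `y` leaves the core graph on
`c`, `d` with two pendant edges `xc` and `yd`. That core graph can be moved away from the pendant edges by adding a clique at `c, d` and
removing a clique at two new vertices, after which the two pendant edges are disjoint from all
the rest. -/
lemma abs_wheelForm_sub_le (hw : 0 ≤ w) (hwn : Fintype.card V * w = 1) (h0 : ∀ x y, 0 ≤ W x y)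
    (h1 : ∀ x y, W x y ≤ 1) (hδ : 0 ≤ δ)
    (hT : ∀ f : Fin (s + 2) → V → ℝ, (∀ i v, 0 ≤ f i v ∧ f i v ≤ w) →
      |cliqueForm W f - P * ∏ i, ∑ v, f i v| ≤ δ)
    {f₁ f₂ f₃ f₄ : V → ℝ} (hf₁ : ∀ v, 0 ≤ f₁ v ∧ f₁ v ≤ w) (hf₂ : ∀ v, 0 ≤ f₂ v ∧ f₂ v ≤ w)
    (hf₃ : ∀ v, 0 ≤ f₃ v ∧ f₃ v ≤ w) (hf₄ : ∀ v, 0 ≤ f₄ v ∧ f₄ v ≤ w) :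
    |wheelForm s w W f₁ f₂ f₃ f₄
      - P * coreDensity s w W * (edgeForm W f₁ f₃ * edgeForm W f₂ f₄)| ≤ 3 * δ := by
  have hmul : ∀ {f : V → ℝ}, (∀ v, 0 ≤ f v ∧ f v ≤ w) → ∀ {u : V → ℝ},
      (∀ v, 0 ≤ u v ∧ u v ≤ 1) → ∀ v, 0 ≤ f v * u v ∧ f v * u v ≤ w := fun hf _ hu v =>
    ⟨mul_nonneg (hf v).1 (hu v).1,
      (mul_le_of_le_one_right (hf v).1 (hu v).2).trans (hf v).2⟩
  obtain ⟨d₁, hd₁e⟩ : ∃ d : V → ℝ, ∀ c, d c = ∑ x, f₁ x * W x c := ⟨_, fun _ => rfl⟩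
  obtain ⟨d₂, hd₂e⟩ : ∃ d : V → ℝ, ∀ c, d c = ∑ x, f₂ x * W x c := ⟨_, fun _ => rfl⟩
  have hd₁ : ∀ v, 0 ≤ d₁ v ∧ d₁ v ≤ 1 := fun v => by
    rw [hd₁e]
    exact ⟨sum_nonneg fun x _ => mul_nonneg (hf₁ x).1 (h0 _ _),
      sum_weight_le_one hwn (hmul hf₁ fun x => ⟨h0 x v, h1 x v⟩)⟩
  have hd₂ : ∀ v, 0 ≤ d₂ v ∧ d₂ v ≤ 1 := fun v => by
    rw [hd₂e]
    exact ⟨sum_nonneg fun x _ => mul_nonneg (hf₂ x).1 (h0 _ _),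
      sum_weight_le_one hwn (hmul hf₂ fun x => ⟨h0 x v, h1 x v⟩)⟩
  have hww : ∀ v : V, 0 ≤ (fun _ : V => w) v ∧ (fun _ : V => w) v ≤ w := fun _ => ⟨hw, le_rfl⟩
  have hg₃ := hmul hf₃ hd₁
  have hg₄ := hmul hf₄ hd₂
  set R := ∑ c, ∑ d, f₃ c * d₁ c * (f₄ d * d₂ d) * W c d * commonNbhd s w W c d with hR
  set X := ∑ c, ∑ d, ∑ x, ∑ y, cliqueNbhd s w W x y c d * (W x y * W c d)
    * (w * w * (f₃ c * d₁ c * (f₄ d * d₂ d))) with hX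
  have hw1 : ∑ _v : V, w = 1 := by rw [sum_const, card_univ, nsmul_eq_mul, hwn]
  have e1 : |wheelForm s w W f₁ f₂ f₃ f₄ - P * R| ≤ δ := by
    have := abs_remove_clique_average_le hw h0 h1 hδ hT (fun c d => f₃ c * f₄ d * W c d)
      (fun c d => mul_nonneg (mul_nonneg (hf₃ c).1 (hf₄ d).1) (h0 c d))
      (sum_sum_mul_le_one hwn hf₃ hf₄ h1)
      (fun c _ x => f₁ x * W x c) (fun _ d y => f₂ y * W y d)
      (fun c _ => hmul hf₁ fun x => ⟨h0 x c, h1 x c⟩)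
      (fun _ d => hmul hf₂ fun x => ⟨h0 x d, h1 x d⟩)
    convert this using 3
    · rw [wheelForm]
      refine sum_congr rfl fun c _ => sum_congr rfl fun d _ => ?_
      rw [mul_sum]
      refine sum_congr rfl fun x _ => ?_
      rw [mul_sum]
      exact sum_congr rfl fun y _ => by ring
    · rw [hR]
      congr 1
      exact sum_congr rfl fun c _ => sum_congr rfl fun d _ => by rw [hd₁e, hd₂e]; ring
  have e2 : |X - P * R| ≤ δ := by
    have := abs_remove_clique_average_le hw h0 h1 hδ hT
      (fun c d => f₃ c * d₁ c * (f₄ d * d₂ d) * W c d)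
      (fun c d => mul_nonneg (mul_nonneg (hg₃ c).1 (hg₄ d).1) (h0 c d))
      (sum_sum_mul_le_one hwn hg₃ hg₄ h1)
      (fun _ _ _ => w) (fun _ _ _ => w) (fun _ _ => hww) (fun _ _ => hww)
    convert this using 3
    · refine sum_congr rfl fun c _ => sum_congr rfl fun d _ => ?_
      rw [mul_sum]
      refine sum_congr rfl fun x _ => ?_
      rw [mul_sum]
      exact sum_congr rfl fun y _ => by ring
    · rw [hR]
      congr 1
      refine sum_congr rfl fun c _ => sum_congr rfl fun d _ => ?_
      rw [hw1]; ring
  have e3 : |X - P * coreDensity s w W * (edgeForm W f₁ f₃ * edgeForm W f₂ f₄)| ≤ δ := by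
    have := abs_remove_clique_average_le hw h0 h1 hδ hT (fun x y => w * w * W x y)
      (fun x y => mul_nonneg (mul_nonneg hw hw) (h0 x y))
      (sum_sum_mul_le_one hwn hww hww h1)
      (fun _ _ c => f₃ c * d₁ c) (fun _ _ d => f₄ d * d₂ d) (fun _ _ => hg₃) (fun _ _ => hg₄)
    convert this using 3
    · rw [hX]
      have h : ∀ F : V → V → V → V → ℝ, ∑ c, ∑ d, ∑ x, ∑ y, F c d x y
          = ∑ x, ∑ y, ∑ c, ∑ d, F c d x y := by
        intro F
        calc ∑ c, ∑ d, ∑ x, ∑ y, F c d x y = ∑ c, ∑ x, ∑ d, ∑ y, F c d x y :=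
              sum_congr rfl fun c _ => sum_comm
          _ = ∑ x, ∑ c, ∑ d, ∑ y, F c d x y := sum_comm
          _ = ∑ x, ∑ c, ∑ y, ∑ d, F c d x y :=
              sum_congr rfl fun x _ => sum_congr rfl fun c _ => sum_comm
          _ = _ := sum_congr rfl fun x _ => sum_comm
      rw [h]
      refine sum_congr rfl fun x _ => sum_congr rfl fun y _ => ?_
      rw [mul_sum]
      refine sum_congr rfl fun c _ => ?_
      rw [mul_sum]
      refine sum_congr rfl fun d _ => ?_
      rw [cliqueNbhd_swap_pairs]
      ring
    · have a1 : ∑ c, f₃ c * d₁ c = edgeForm W f₁ f₃ := by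
        rw [edgeForm, sum_comm]
        refine sum_congr rfl fun c _ => ?_
        rw [hd₁e, mul_sum]
        exact sum_congr rfl fun x _ => by ring
      have a2 : ∑ c, f₄ c * d₂ c = edgeForm W f₂ f₄ := by
        rw [edgeForm, sum_comm]
        refine sum_congr rfl fun c _ => ?_
        rw [hd₂e, mul_sum]
        exact sum_congr rfl fun x _ => by ring
      simp only [a1, a2]
      rw [mul_assoc, coreDensity]
      congr 1
      rw [sum_mul]
      refine sum_congr rfl fun x _ => ?_
      rw [sum_mul]
      exact sum_congr rfl fun y _ => by ring
  rw [abs_le] at e1 e2 e3 ⊢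
  constructor <;> linarith

lemma sub_le_coreDensity (hw : 0 ≤ w) (hwn : Fintype.card V * w = 1) (h0 : ∀ x y, 0 ≤ W x y)
    (h1 : ∀ x y, W x y ≤ 1)
    (hT : ∀ f : Fin (s + 2) → V → ℝ, (∀ i v, 0 ≤ f i v ∧ f i v ≤ w) →
      |cliqueForm W f - P * ∏ i, ∑ v, f i v| ≤ δ) :
    P - δ ≤ coreDensity s w W := by
  have hw1 : ∑ _v : V, w = 1 := by rw [sum_const, card_univ, nsmul_eq_mul, hwn]
  have h := hT (Fin.cons (fun _ => w) (Fin.cons (fun _ => w) fun _ _ => w)) (by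
    intro i v
    refine Fin.cases ?_ (fun i => ?_) i
    · simp [hw]
    · refine Fin.cases ?_ (fun i => ?_) i <;> simp [hw])
  rw [cliqueForm_cons_cons, Fin.prod_univ_succ, Fin.prod_univ_succ] at h
  simp only [Fin.cons_zero, Fin.cons_succ, hw1, prod_const, one_pow, mul_one, card_univ,
    Fintype.card_fin] at h
  have hle : ∑ x, ∑ y, (∑ a : Fin s → V, w ^ s * cliqueKernel W a * joinKernel W a x
      * joinKernel W a y) * W x y * w * w ≤ coreDensity s w W := by
    refine sum_le_sum fun x _ => sum_le_sum fun y _ => ?_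
    have : ∑ a : Fin s → V, w ^ s * cliqueKernel W a * joinKernel W a x * joinKernel W a y
        ≤ commonNbhd s w W x y := by
      refine sum_le_sum fun a _ => ?_
      rw [mul_assoc]
      exact mul_le_mul_of_nonneg_right
        (mul_le_of_le_one_right (pow_nonneg hw s) (cliqueKernel_le_one h0 h1 a))
        (mul_nonneg (joinKernel_nonneg h0 a x) (joinKernel_nonneg h0 a y))
    have h2 := mul_le_mul_of_nonneg_left this (mul_nonneg (mul_nonneg hw hw) (h0 x y))
    linarith
  have := (abs_le.1 h).1
  linarith

lemma coreDensity_le_edgeForm (hw : 0 ≤ w) (hwn : Fintype.card V * w = 1)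
    (h0 : ∀ x y, 0 ≤ W x y) (h1 : ∀ x y, W x y ≤ 1) :
    coreDensity s w W ≤ edgeForm W (fun _ => w) fun _ => w :=
  sum_le_sum fun x _ => sum_le_sum fun y _ =>
    mul_le_of_le_one_right (mul_nonneg (mul_nonneg hw hw) (h0 x y))
      (commonNbhd_le_one hw hwn h0 h1 x y)

/-- The edge form is nearly of rank one: two disjoint edges may exchange their endpoints. -/
theorem abs_edgeForm_exchange_le (hw : 0 ≤ w) (hwn : Fintype.card V * w = 1)
    (h0 : ∀ x y, 0 ≤ W x y) (h1 : ∀ x y, W x y ≤ 1)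
    (hδ : 0 ≤ δ) (hP : 0 < P) (hδP : δ ≤ P / 2)
    (hT : ∀ f : Fin (s + 2) → V → ℝ, (∀ i v, 0 ≤ f i v ∧ f i v ≤ w) →
      |cliqueForm W f - P * ∏ i, ∑ v, f i v| ≤ δ)
    {f₁ f₂ f₃ f₄ : V → ℝ} (hf₁ : ∀ v, 0 ≤ f₁ v ∧ f₁ v ≤ w) (hf₂ : ∀ v, 0 ≤ f₂ v ∧ f₂ v ≤ w)
    (hf₃ : ∀ v, 0 ≤ f₃ v ∧ f₃ v ≤ w) (hf₄ : ∀ v, 0 ≤ f₄ v ∧ f₄ v ≤ w) :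
    |edgeForm W f₁ f₂ * edgeForm W f₃ f₄ - edgeForm W f₁ f₃ * edgeForm W f₂ f₄|
      ≤ 12 * δ / P ^ 2 := by
  have e1 := abs_wheelForm_sub_le hw hwn h0 h1 hδ hT hf₁ hf₂ hf₃ hf₄
  have e2 := abs_wheelForm_sub_le hw hwn h0 h1 hδ hT hf₁ hf₃ hf₂ hf₄
  rw [← wheelForm_swap] at e2
  have hτ := sub_le_coreDensity hw hwn h0 h1 hT
  set τ := coreDensity s w W
  set A := edgeForm W f₁ f₂ * edgeForm W f₃ f₄
  set B := edgeForm W f₁ f₃ * edgeForm W f₂ f₄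
  have h6 : P * τ * |A - B| ≤ 6 * δ := by
    rw [← abs_of_nonneg (show 0 ≤ P * τ from mul_nonneg hP.le (by linarith)), ← abs_mul]
    rw [abs_le] at e1 e2 ⊢
    constructor <;> nlinarith
  have h7 : P * (P / 2) * |A - B| ≤ P * τ * |A - B| :=
    mul_le_mul_of_nonneg_right (mul_le_mul_of_nonneg_left (by linarith) hP.le) (abs_nonneg _)
  rw [le_div_iff₀ (by positivity)]
  nlinarith

end Exchange

end EdgeExchange

/-! ### Counting in a kernel that is nearly of rank one -/

section RankOneCounting

variable {V : Type*} {r : ℕ}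

/-- The number of pairs in `E` that contain the index `i`. -/
def incidence (E : Finset (Fin r × Fin r)) (i : Fin r) : ℕ :=
  (E.filter fun e => e.1 = i ∨ e.2 = i).card

lemma incidence_insert {E : Finset (Fin r × Fin r)} {e : Fin r × Fin r} (he : e ∉ E) (k : Fin r) :
    incidence (insert e E) k = (if k = e.1 ∨ k = e.2 then 1 else 0) + incidence E k := by
  unfold incidence
  rw [filter_insert]
  by_cases h : e.1 = k ∨ e.2 = k
  · rw [if_pos h, if_pos (by simpa [eq_comm] using h), card_insert_of_notMem (by simp [he]),
      add_comm]
  · rw [if_neg h, if_neg (by simpa [eq_comm] using h), zero_add]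

lemma incidence_pairs (i : Fin r) : incidence (pairs r) i = r - 1 := by
  have : (univ.erase i).card = r - 1 := by rw [card_erase_of_mem (mem_univ i)]; simp
  rw [← this, incidence]
  refine card_bij' (fun e _ => if e.1 = i then e.2 else e.1)
    (fun j _ => if j < i then (j, i) else (i, j)) ?_ ?_ ?_ ?_
  · rintro ⟨a, b⟩ h
    simp only [pairs, mem_filter, mem_univ, true_and] at h
    simp only [mem_erase, mem_univ, and_true]
    split_ifs with h1
    · subst h1; exact h.1.ne'
    · exact h1
  · intro j hj
    have hj := ne_of_mem_erase hj
    simp only [pairs, mem_filter, mem_univ, true_and]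
    split_ifs with h1
    · exact ⟨h1, Or.inr rfl⟩
    · exact ⟨lt_of_le_of_ne (not_lt.1 h1) hj.symm, Or.inl rfl⟩
  · rintro ⟨a, b⟩ h
    simp only [pairs, mem_filter, mem_univ, true_and] at h
    obtain ⟨hab, rfl | rfl⟩ := h
    · simp [hab.not_gt]
    · simp [hab, hab.ne]
  · intro j hj
    have hj := ne_of_mem_erase hj
    split_ifs <;> simp_all

/-- A product of values of `W` over pairs other than `(i, j)` splits into a factor for the entry
at `i` and a factor for the entry at `j`. -/
lemma exists_prod_update_eq {W : V → V → ℝ} (h0 : ∀ x y, 0 ≤ W x y) (h1 : ∀ x y, W x y ≤ 1)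
    {i j : Fin r} (hij : i < j) (x : Fin r → V) (E : Finset (Fin r × Fin r)) (hE : E ⊆ pairs r)
    (he : (i, j) ∉ E) :
    ∃ F G : V → ℝ, (∀ y, 0 ≤ F y ∧ F y ≤ 1) ∧ (∀ z, 0 ≤ G z ∧ G z ≤ 1) ∧ ∀ y z,
      ∏ e ∈ E, W (Function.update (Function.update x i y) j z e.1)
        (Function.update (Function.update x i y) j z e.2) = F y * G z := by
  induction E using Finset.induction_on with
  | empty => exact ⟨fun _ => 1, fun _ => 1, by simp, by simp, by simp⟩
  | insert e E heE ih =>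
    obtain ⟨F, G, hF, hG, hFG⟩ := ih ((subset_insert _ _).trans hE)
      fun h => he (mem_insert_of_mem h)
    obtain ⟨k, l⟩ := e
    have hkl : k < l := by simpa [pairs] using hE (mem_insert_self _ _)
    have hne : ¬ (k = i ∧ l = j) := by
      rintro ⟨rfl, rfl⟩; exact he (mem_insert_self _ _)
    by_cases hj : k = j ∨ l = j
    · have hki : k ≠ i := by
        rintro rfl
        rcases hj with rfl | rfl
        · exact lt_irrefl _ hij
        · exact hne ⟨rfl, rfl⟩
      have hli : l ≠ i := by
        rintro rfl
        rcases hj with rfl | rfl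
        · exact lt_asymm hkl hij
        · exact lt_irrefl _ hij
      refine ⟨F, fun z => W (Function.update x j z k) (Function.update x j z l) * G z, hF,
        fun z => ⟨mul_nonneg (h0 _ _) (hG z).1, mul_le_one₀ (h1 _ _) (hG z).1 (hG z).2⟩, ?_⟩
      intro y z
      rw [prod_insert heE, hFG, Function.update_comm hij.ne,
        Function.update_of_ne hki, Function.update_of_ne hli]
      ring
    · push Not at hj
      refine ⟨fun y => W (Function.update x i y k) (Function.update x i y l) * F y, G,
        fun z => ⟨mul_nonneg (h0 _ _) (hF z).1, mul_le_one₀ (h1 _ _) (hF z).1 (hF z).2⟩, hG, ?_⟩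
      intro y z
      rw [prod_insert heE, hFG, Function.update_of_ne hj.1, Function.update_of_ne hj.2]
      ring

variable [Fintype V]

/-- The weighted count of homomorphisms from the graph on `Fin r` with edge set `E`. -/
def patternForm (W : V → V → ℝ) (E : Finset (Fin r × Fin r)) (f : Fin r → V → ℝ) : ℝ :=
  ∑ x : Fin r → V, (∏ i, f i (x i)) * ∏ e ∈ E, W (x e.1) (x e.2)

lemma sum_sum_update (Ξ : (Fin r → V) → ℝ) (i : Fin r) :
    ∑ x, ∑ y, Ξ (Function.update x i y) = Fintype.card V * ∑ x, Ξ x := by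
  have hinv : Function.Involutive fun q : (Fin r → V) × V => (Function.update q.1 i q.2, q.1 i) :=
    fun q => by simp
  rw [← Fintype.sum_prod_type' (f := fun x y => Ξ (Function.update x i y)),
    ← Equiv.sum_comp hinv.toPerm]
  simp [Fintype.sum_prod_type, mul_sum]

/-- Replacing one edge of a pattern by the rank-one kernel `h ⊗ h`, which is absorbed into the
weights of the two endpoints. -/
lemma abs_patternForm_insert_le [Nonempty V] {W : V → V → ℝ} (h0 : ∀ x y, 0 ≤ W x y)
    (h1 : ∀ x y, W x y ≤ 1) {ω h : V → ℝ} {m L η : ℝ} (hω1 : ∑ v, ω v ≤ 1)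
    (hη0 : 0 ≤ η)
    (hη : ∀ f g : V → ℝ, (∀ v, 0 ≤ f v ∧ f v ≤ ω v) → (∀ v, 0 ≤ g v ∧ g v ≤ ω v) →
      |m * edgeForm W f g - L * ((∑ v, f v * h v) * ∑ v, g v * h v)| ≤ η)
    {f : Fin r → V → ℝ} (hf : ∀ i v, 0 ≤ f i v ∧ f i v ≤ ω v)
    {i j : Fin r} (hij : i < j) {E : Finset (Fin r × Fin r)} (hE : E ⊆ pairs r)
    (he : (i, j) ∉ E) :
    |m * patternForm W (insert (i, j) E) f
      - L * patternForm W E (fun k v => f k v * h v ^ (if k = i ∨ k = j then 1 else 0))| ≤ η := by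
  set n : ℝ := (Fintype.card V : ℝ) with hn
  have hn0 : 0 < n := by rw [hn]; exact_mod_cast Fintype.card_pos
  let S : Finset (Fin r) := (univ.erase i).erase j
  have hsplit : ∀ F : Fin r → ℝ, ∏ k, F k = F i * (F j * ∏ k ∈ S, F k) := by
    intro F
    rw [← mul_prod_erase univ F (mem_univ i),
      ← mul_prod_erase (univ.erase i) F (mem_erase.2 ⟨hij.ne', mem_univ j⟩)]
  have hS : ∀ k ∈ S, k ≠ i ∧ k ≠ j := fun k hk =>
    ⟨ne_of_mem_erase (mem_of_mem_erase hk), ne_of_mem_erase hk⟩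
  let Ξ : (Fin r → V) → ℝ := fun x =>
    m * ((∏ k, f k (x k)) * (W (x i) (x j) * ∏ e ∈ E, W (x e.1) (x e.2)))
      - L * ((∏ k, f k (x k) * h (x k) ^ (if k = i ∨ k = j then 1 else 0))
        * ∏ e ∈ E, W (x e.1) (x e.2))
  have hΞ : m * patternForm W (insert (i, j) E) f
      - L * patternForm W E (fun k v => f k v * h v ^ (if k = i ∨ k = j then 1 else 0))
        = ∑ x, Ξ x := by
    rw [patternForm, patternForm, mul_sum, mul_sum, ← sum_sub_distrib]
    exact sum_congr rfl fun x _ => by rw [prod_insert he]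
  -- All entries of `x` other than those at `i` and `j` are held fixed.
  have hslice : ∀ x : Fin r → V,
      |∑ y, ∑ z, Ξ (Function.update (Function.update x i y) j z)|
        ≤ η * ∏ k ∈ S, f k (x k) := by
    intro x
    obtain ⟨F, G, hF, hG, hFG⟩ := exists_prod_update_eq h0 h1 hij x E hE he
    have hb := hη (fun v => f i v * F v) (fun v => f j v * G v)
      (fun v => ⟨mul_nonneg (hf i v).1 (hF v).1,
        (mul_le_of_le_one_right (hf i v).1 (hF v).2).trans (hf i v).2⟩)
      (fun v => ⟨mul_nonneg (hf j v).1 (hG v).1,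
        (mul_le_of_le_one_right (hf j v).1 (hG v).2).trans (hf j v).2⟩)
    have hρ : 0 ≤ ∏ k ∈ S, f k (x k) := prod_nonneg fun k _ => (hf k _).1
    have heq : ∑ y, ∑ z, Ξ (Function.update (Function.update x i y) j z)
        = (m * edgeForm W (fun v => f i v * F v) (fun v => f j v * G v)
          - L * ((∑ v, f i v * F v * h v) * ∑ v, f j v * G v * h v)) * ∏ k ∈ S, f k (x k) := by
      rw [edgeForm, sum_mul_sum, mul_sum, mul_sum, ← sum_sub_distrib, sum_mul]
      refine sum_congr rfl fun y _ => ?_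
      rw [mul_sum, mul_sum, ← sum_sub_distrib, sum_mul]
      refine sum_congr rfl fun z _ => ?_
      have hui : Function.update (Function.update x i y) j z i = y := by
        rw [Function.update_of_ne hij.ne, Function.update_self]
      have huj : Function.update (Function.update x i y) j z j = z := Function.update_self ..
      have huk : ∀ k ∈ S, Function.update (Function.update x i y) j z k = x k := fun k hk => by
        rw [Function.update_of_ne (hS k hk).2, Function.update_of_ne (hS k hk).1]
      have hp1 : ∏ k ∈ S, f k (Function.update (Function.update x i y) j z k)
          = ∏ k ∈ S, f k (x k) := prod_congr rfl fun k hk => by rw [huk k hk]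
      have hp2 : ∏ k ∈ S, (f k (Function.update (Function.update x i y) j z k)
          * h (Function.update (Function.update x i y) j z k) ^ (if k = i ∨ k = j then 1 else 0))
          = ∏ k ∈ S, f k (x k) := prod_congr rfl fun k hk => by
        rw [huk k hk, if_neg (not_or.2 (hS k hk)), pow_zero, mul_one]
      simp only [Ξ]
      rw [hsplit, hsplit, hp1, hp2, hFG, hui, huj]
      simp only [true_or, or_true, if_true, pow_one]
      ring
    rw [heq, abs_mul, abs_of_nonneg hρ]
    exact mul_le_mul_of_nonneg_right hb hρ
  have hρsum : ∑ x : Fin r → V, ∏ k ∈ S, f k (x k) ≤ n * n := by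
    have h2 : ∀ x : Fin r → V, ∏ k ∈ S, f k (x k)
        = ∏ k, (if k = i ∨ k = j then 1 else f k (x k)) := by
      intro x
      rw [hsplit]
      simp only [true_or, or_true, if_true, one_mul]
      exact prod_congr rfl fun k hk => by rw [if_neg (not_or.2 (hS k hk))]
    simp_rw [h2]
    have h3 := Finset.prod_univ_sum (fun _ : Fin r => (univ : Finset V))
      (fun k v => if k = i ∨ k = j then (1 : ℝ) else f k v)
    rw [Fintype.piFinset_univ] at h3
    rw [← h3, hsplit]
    simp only [true_or, or_true, if_true, sum_const, card_univ, nsmul_eq_mul, mul_one]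
    rw [← hn, ← mul_assoc]
    refine mul_le_of_le_one_right (by positivity) (prod_le_one ?_ ?_)
    · intro k hk
      simp only [if_neg (not_or.2 (hS k hk))]
      exact sum_nonneg fun v _ => (hf k v).1
    · intro k hk
      simp only [if_neg (not_or.2 (hS k hk))]
      exact (sum_le_sum fun v _ => (hf k v).2).trans hω1
  have htotal : n * n * ∑ x, Ξ x
      = ∑ x, ∑ y, ∑ z, Ξ (Function.update (Function.update x i y) j z) := by
    rw [sum_sum_update (fun x => ∑ z, Ξ (Function.update x j z)) i, sum_sum_update, mul_assoc]
  have hle : n * n * |∑ x, Ξ x| ≤ η * (n * n) := by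
    rw [← abs_of_pos (mul_pos hn0 hn0), ← abs_mul, htotal, abs_of_pos (mul_pos hn0 hn0)]
    calc _ ≤ ∑ x : Fin r → V, η * ∏ k ∈ S, f k (x k) :=
          (abs_sum_le_sum_abs _ _).trans (sum_le_sum fun x _ => hslice x)
      _ = η * ∑ x : Fin r → V, ∏ k ∈ S, f k (x k) := by rw [mul_sum]
      _ ≤ η * (n * n) := mul_le_mul_of_nonneg_left hρsum hη0
  rw [hΞ]
  have : 0 < n * n := mul_pos hn0 hn0
  nlinarith

/-- The counting lemma for a kernel that is close to `L / m` times `h ⊗ h`. The edges of the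
pattern are replaced one at a time; the error of each step carries the factors `m` of the edges
not yet replaced and the factors `L` of those already replaced. -/
theorem abs_patternForm_sub_le [Nonempty V] {W : V → V → ℝ} (h0 : ∀ x y, 0 ≤ W x y)
    (h1 : ∀ x y, W x y ≤ 1) {ω h : V → ℝ} {m L η : ℝ} (hω1 : ∑ v, ω v ≤ 1)
    (hh : ∀ v, 0 ≤ h v ∧ h v ≤ 1) (hm : 0 ≤ m) (hL : 0 ≤ L) (hη0 : 0 ≤ η)
    (hη : ∀ f g : V → ℝ, (∀ v, 0 ≤ f v ∧ f v ≤ ω v) → (∀ v, 0 ≤ g v ∧ g v ≤ ω v) →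
      |m * edgeForm W f g - L * ((∑ v, f v * h v) * ∑ v, g v * h v)| ≤ η)
    (E : Finset (Fin r × Fin r)) (hE : E ⊆ pairs r)
    (f : Fin r → V → ℝ) (hf : ∀ i v, 0 ≤ f i v ∧ f i v ≤ ω v) :
    |m ^ E.card * patternForm W E f - L ^ E.card * ∏ i, ∑ v, f i v * h v ^ incidence E i|
      ≤ η * ∑ k ∈ range E.card, m ^ k * L ^ (E.card - 1 - k) := by
  induction E using Finset.induction_on generalizing f with
  | empty =>
    have h3 := Finset.prod_univ_sum (fun _ : Fin r => (univ : Finset V)) f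
    rw [Fintype.piFinset_univ] at h3
    simp [patternForm, incidence, h3]
  | insert e E heE ih =>
    obtain ⟨i, j⟩ := e
    have hij : i < j := by simpa [pairs] using hE (mem_insert_self _ _)
    have hE' := (subset_insert _ _).trans hE
    set f' : Fin r → V → ℝ := fun k v => f k v * h v ^ (if k = i ∨ k = j then 1 else 0) with hf'
    have hstep := abs_patternForm_insert_le h0 h1 hω1 hη0 hη hf hij hE' heE
    have hrest := ih hE' f' fun k v => ⟨mul_nonneg (hf k v).1 (pow_nonneg (hh v).1 _),
      (mul_le_of_le_one_right (hf k v).1 (pow_le_one₀ (hh v).1 (hh v).2)).trans (hf k v).2⟩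
    have hprod : ∏ k, ∑ v, f' k v * h v ^ incidence E k
        = ∏ k, ∑ v, f k v * h v ^ incidence (insert (i, j) E) k := by
      refine prod_congr rfl fun k _ => sum_congr rfl fun v _ => ?_
      rw [incidence_insert heE, pow_add, hf', mul_assoc]
    rw [hprod] at hrest
    rw [card_insert_of_notMem heE, add_tsub_cancel_right, geom_sum₂_succ_eq]
    set A := patternForm W (insert (i, j) E) f
    set B := patternForm W E f'
    set D := ∏ k, ∑ v, f k v * h v ^ incidence (insert (i, j) E) k
    calc |m ^ (E.card + 1) * A - L ^ (E.card + 1) * D|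
        = |m ^ E.card * (m * A - L * B) + L * (m ^ E.card * B - L ^ E.card * D)| := by
          congr 1; ring
      _ ≤ m ^ E.card * |m * A - L * B| + L * |m ^ E.card * B - L ^ E.card * D| := by
          refine (abs_add_le _ _).trans_eq ?_
          rw [abs_mul, abs_mul, abs_of_nonneg (pow_nonneg hm _), abs_of_nonneg hL]
      _ ≤ m ^ E.card * η + L * (η * ∑ k ∈ range E.card, m ^ k * L ^ (E.card - 1 - k)) := by
          gcongr
      _ = _ := by ring

end RankOneCounting

/-! ### Nearly constant degrees -/

section DegreeRegularity

lemma pow_mul_abs_sub_le {a b : ℝ} (ha : 0 ≤ a) (hb : 0 ≤ b) (k : ℕ) :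
    b ^ k * |a - b| ≤ |a ^ (k + 1) - b ^ (k + 1)| := by
  rcases le_total a b with h | h
  · have h1 : a ^ k ≤ b ^ k := pow_le_pow_left₀ ha h k
    have h2 : a ^ (k + 1) ≤ b ^ (k + 1) := pow_le_pow_left₀ ha h _
    rw [abs_of_nonpos (by linarith), abs_of_nonpos (by linarith), pow_succ, pow_succ]
    nlinarith
  · have h1 : b ^ k ≤ a ^ k := pow_le_pow_left₀ hb h k
    have h2 : b ^ (k + 1) ≤ a ^ (k + 1) := pow_le_pow_left₀ hb h _
    rw [abs_of_nonneg (by linarith), abs_of_nonneg (by linarith), pow_succ, pow_succ]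
    nlinarith

lemma abs_pow_sub_pow_mul_le {a b : ℝ} (ha : 0 ≤ a) (hb : 0 ≤ b) (k : ℕ) :
    |a ^ k - b ^ k| * b ≤ |a ^ (k + 1) - b ^ (k + 1)| := by
  rcases le_total a b with h | h
  · have h1 : a ^ k ≤ b ^ k := pow_le_pow_left₀ ha h k
    have h2 : a ^ (k + 1) ≤ b ^ (k + 1) := pow_le_pow_left₀ ha h _
    have h3 : 0 ≤ a ^ k := pow_nonneg ha k
    rw [abs_of_nonpos (by linarith), abs_of_nonpos (by linarith), pow_succ, pow_succ]
    nlinarith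
  · have h1 : b ^ k ≤ a ^ k := pow_le_pow_left₀ hb h k
    have h2 : b ^ (k + 1) ≤ a ^ (k + 1) := pow_le_pow_left₀ hb h _
    have h3 : 0 ≤ a ^ k := pow_nonneg ha k
    rw [abs_of_nonneg (by linarith), abs_of_nonneg (by linarith), pow_succ, pow_succ]
    nlinarith

variable {V : Type*} [Fintype V] {r : ℕ}

/-- A function that is small on average against all weights is small in the mean. -/
lemma sum_mul_abs_le_of_weights {w B : ℝ} (hw : 0 ≤ w) (u : V → ℝ)
    (hB : ∀ f : V → ℝ, (∀ v, 0 ≤ f v ∧ f v ≤ w) → |∑ v, f v * u v| ≤ B) :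
    ∑ v, w * |u v| ≤ 2 * B := by
  have h1 := hB (fun v => if 0 ≤ u v then w else 0) fun v => by
    split_ifs <;> simp [hw]
  have h2 := hB (fun v => if 0 ≤ u v then 0 else w) fun v => by
    split_ifs <;> simp [hw]
  have h3 : ∑ v, w * |u v| = ∑ v, (if 0 ≤ u v then w else 0) * u v
      - ∑ v, (if 0 ≤ u v then 0 else w) * u v := by
    rw [← sum_sub_distrib]
    refine sum_congr rfl fun v _ => ?_
    split_ifs with h
    · rw [abs_of_nonneg h]; ring
    · rw [abs_of_nonpos (not_le.1 h).le]; ring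
  rw [h3]
  rw [abs_le] at h1 h2
  linarith [h1.2, h2.1]

/-- The normalized degree of a vertex. -/
def degree (w : ℝ) (W : V → V → ℝ) (v : V) : ℝ := ∑ x, w * W v x

section Degree

variable {W : V → V → ℝ} {w : ℝ}

lemma degree_nonneg (hw : 0 ≤ w) (h0 : ∀ x y, 0 ≤ W x y) (v : V) : 0 ≤ degree w W v :=
  sum_nonneg fun x _ => mul_nonneg hw (h0 v x)

lemma degree_le_one (hw : 0 ≤ w) (hwn : Fintype.card V * w = 1) (h0 : ∀ x y, 0 ≤ W x y)
    (h1 : ∀ x y, W x y ≤ 1) (v : V) : degree w W v ≤ 1 :=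
  sum_weight_le_one hwn fun x => ⟨mul_nonneg hw (h0 v x), mul_le_of_le_one_right hw (h1 v x)⟩

lemma edgeForm_const (f : V → ℝ) : edgeForm W f (fun _ => w) = ∑ v, f v * degree w W v := by
  refine sum_congr rfl fun v _ => ?_
  rw [degree, mul_sum]
  exact sum_congr rfl fun x _ => by ring

/-- The consequence of the hereditary clique count that carries the rest of the proof. -/
lemma abs_edgeForm_rank_one_le {s : ℕ} {P δ : ℝ} (hw : 0 ≤ w) (hwn : Fintype.card V * w = 1)
    (h0 : ∀ x y, 0 ≤ W x y) (h1 : ∀ x y, W x y ≤ 1)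
    (hδ : 0 ≤ δ) (hP : 0 < P) (hδP : δ ≤ P / 2)
    (hT : ∀ f : Fin (s + 2) → V → ℝ, (∀ i v, 0 ≤ f i v ∧ f i v ≤ w) →
      |cliqueForm W f - P * ∏ i, ∑ v, f i v| ≤ δ)
    {f g : V → ℝ} (hf : ∀ v, 0 ≤ f v ∧ f v ≤ w) (hg : ∀ v, 0 ≤ g v ∧ g v ≤ w) :
    |(∑ v, w * degree w W v) * edgeForm W f g
      - (∑ v, f v * degree w W v) * ∑ v, g v * degree w W v| ≤ 12 * δ / P ^ 2 := by
  have hc : ∀ v : V, 0 ≤ (fun _ : V => w) v ∧ (fun _ : V => w) v ≤ w := fun _ => ⟨hw, le_rfl⟩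
  have := abs_edgeForm_exchange_le hw hwn h0 h1 hδ hP hδP hT hf hg hc hc
  rw [edgeForm_const, edgeForm_const, edgeForm_const] at this
  rwa [mul_comm (∑ v, w * degree w W v)]

/-- A lower bound of the right order for the edge density `m`. At least half of the vertices have
degree at most `2 * m`, and among these the number of cliques is of order at most `m ^ e`. -/
lemma div_sixteen_le_density [Nonempty V] (hr : 3 ≤ r) {p δ m : ℝ} (hp : 0 < p) (hw : 0 ≤ w)
    (hwn : Fintype.card V * w = 1)
    (h0 : ∀ x y, 0 ≤ W x y) (h1 : ∀ x y, W x y ≤ 1) (hδ : 0 ≤ δ)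
    (hT : ∀ f : Fin r → V → ℝ, (∀ i v, 0 ≤ f i v ∧ f i v ≤ w) →
      |cliqueForm W f - p ^ (pairs r).card * ∏ i, ∑ v, f i v| ≤ δ)
    (hm : m = ∑ v, w * degree w W v) (hmp : p ^ (pairs r).card / 2 ≤ m) (hm1 : m ≤ 1)
    (hη : ∀ f g : V → ℝ, (∀ v, 0 ≤ f v ∧ f v ≤ w) → (∀ v, 0 ≤ g v ∧ g v ≤ w) →
      |m * edgeForm W f g - (∑ v, f v * degree w W v) * ∑ v, g v * degree w W v|
        ≤ 12 * δ / (p ^ (pairs r).card) ^ 2)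
    (hp1 : p ≤ 1)
    (hδp : δ * ((1 + 24 * (pairs r).card * 4 ^ (pairs r).card) * 2 ^ (r + 1))
      ≤ (p ^ (pairs r).card) ^ 4) :
    p / 16 ≤ m := by
  classical
  set e := (pairs r).card with he
  set P := p ^ e with hP
  set η := 12 * δ / P ^ 2 with hηdef
  set d := degree w W with hd
  have hP0 : 0 < P := pow_pos hp e
  have hP1 : P ≤ 1 := pow_le_one₀ hp.le hp1
  have hm0 : 0 < m := lt_of_lt_of_le (by positivity) hmp
  have hη0 : 0 ≤ η := by positivity
  have hd0 : ∀ v, 0 ≤ d v := degree_nonneg hw h0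
  let ω : V → ℝ := fun v => if d v ≤ 2 * m then w else 0
  let h : V → ℝ := fun v => if d v ≤ 2 * m then d v / (2 * m) else 0
  have hω : ∀ v, 0 ≤ ω v ∧ ω v ≤ w := fun v => by simp only [ω]; split_ifs <;> simp [hw]
  have hω1 : ∑ v, ω v ≤ 1 := sum_weight_le_one hwn hω
  have hh : ∀ v, 0 ≤ h v ∧ h v ≤ 1 := fun v => by
    simp only [h]
    split_ifs with hv
    · exact ⟨div_nonneg (hd0 v) (by positivity), (div_le_one (by positivity)).2 hv⟩
    · simp
  have hhalf : 1 / 2 ≤ ∑ v, ω v := by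
    have hw1 : ∑ _v : V, w = 1 := by rw [sum_const, card_univ, nsmul_eq_mul, hwn]
    have h2 : ∑ v, (w - ω v) * (2 * m) ≤ m := by
      refine (sum_le_sum fun v _ => ?_).trans_eq hm.symm
      simp only [ω]
      split_ifs with hv
      · rw [sub_self, zero_mul]; exact mul_nonneg hw (hd0 v)
      · rw [sub_zero]; exact mul_le_mul_of_nonneg_left (not_le.1 hv).le hw
    rw [← sum_mul, sum_sub_distrib, hw1] at h2
    nlinarith
  have hfd : ∀ f : V → ℝ, (∀ v, 0 ≤ f v ∧ f v ≤ ω v) →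
      ∑ v, f v * d v = 2 * m * ∑ v, f v * h v := by
    intro f hf
    rw [mul_sum]
    refine sum_congr rfl fun v _ => ?_
    have hv := hf v
    simp only [ω, h] at hv ⊢
    split_ifs at hv ⊢ with hv'
    · field_simp
    · rw [le_antisymm hv.2 hv.1]; ring
  have htel := abs_patternForm_sub_le (L := 4 * m ^ 2) h0 h1 hω1 hh hm0.le (by positivity) hη0
    (fun f g hf hg => by
      have := hη f g (fun v => ⟨(hf v).1, (hf v).2.trans (hω v).2⟩)
        (fun v => ⟨(hg v).1, (hg v).2.trans (hω v).2⟩)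
      rw [hfd f hf, hfd g hg] at this
      convert this using 3
      ring)
    (pairs r) subset_rfl (fun _ => ω) (fun _ v => ⟨(hω v).1, le_rfl⟩)
  have hform : patternForm W (pairs r) (fun _ : Fin r => ω) = cliqueForm W fun _ => ω := rfl
  rw [hform, ← he] at htel
  have hprod1 : ∏ i : Fin r, ∑ v, ω v * h v ^ incidence (pairs r) i ≤ 1 := by
    refine prod_le_one (fun i _ => sum_nonneg fun v _ =>
      mul_nonneg (hω v).1 (pow_nonneg (hh v).1 _)) fun i _ => ?_
    refine (sum_le_sum fun v _ => ?_).trans hω1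
    exact mul_le_of_le_one_right (hω v).1 (pow_le_one₀ (hh v).1 (hh v).2)
  have he0 : 1 ≤ e := by
    have := two_mul_card_pairs r
    have : 3 * 2 ≤ r * (r - 1) := Nat.mul_le_mul hr (by omega)
    omega
  have hgeom : ∑ k ∈ range e, m ^ k * (4 * m ^ 2) ^ (e - 1 - k) ≤ e * 4 ^ e * m ^ (e - 1) := by
    calc ∑ k ∈ range e, m ^ k * (4 * m ^ 2) ^ (e - 1 - k)
        ≤ ∑ k ∈ range e, 4 ^ e * m ^ (e - 1) := by
          refine sum_le_sum fun k hk => ?_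
          have hk := mem_range.1 hk
          calc m ^ k * (4 * m ^ 2) ^ (e - 1 - k)
              = 4 ^ (e - 1 - k) * (m ^ (e - 1 - k) * m ^ k) * m ^ (e - 1 - k) := by
                rw [mul_pow, ← pow_mul, two_mul, pow_add]; ring
            _ = 4 ^ (e - 1 - k) * m ^ (e - 1) * m ^ (e - 1 - k) := by
                rw [← pow_add]; congr 3; omega
            _ ≤ 4 ^ e * m ^ (e - 1) * 1 := by
                gcongr
                · norm_num
                · omega
                · exact pow_le_one₀ hm0.le hm1
            _ = _ := by ring
      _ = _ := by rw [sum_const, card_range, nsmul_eq_mul]; ring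
  have hTω := hT (fun _ => ω) fun _ => hω
  have hcl : P / 2 ^ r - δ ≤ cliqueForm W fun _ : Fin r => ω := by
    have h2 : (1 / 2 : ℝ) ^ r ≤ ∏ _i : Fin r, ∑ v, ω v := by
      rw [prod_const, card_univ, Fintype.card_fin]
      exact pow_le_pow_left₀ (by norm_num) hhalf r
    have h3 : P * (1 / 2) ^ r ≤ P * ∏ _i : Fin r, ∑ v, ω v :=
      mul_le_mul_of_nonneg_left h2 hP0.le
    have h4 : P / 2 ^ r = P * (1 / 2) ^ r := by rw [div_pow, one_pow]; ring
    have h5 := (abs_le.1 hTω).1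
    rw [h4]; linarith
  have hmain : m ^ e * (P / 2 ^ r - δ) ≤ m ^ e * (4 ^ e * m ^ e + e * 4 ^ e * (η / m)) := by
    have h2 : m ^ e * (P / 2 ^ r - δ) ≤ m ^ e * cliqueForm W fun _ : Fin r => ω :=
      mul_le_mul_of_nonneg_left hcl (by positivity)
    have h3 := (abs_le.1 htel).2
    have h4 : (4 * m ^ 2) ^ e * ∏ i : Fin r, ∑ v, ω v * h v ^ incidence (pairs r) i
        ≤ (4 * m ^ 2) ^ e := mul_le_of_le_one_right (by positivity) hprod1
    have h5 := mul_le_mul_of_nonneg_left hgeom hη0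
    have h6 : (4 * m ^ 2) ^ e = m ^ e * (4 ^ e * m ^ e) := by
      rw [mul_pow, ← pow_mul, two_mul, pow_add]; ring
    have h7 : η * (e * 4 ^ e * m ^ (e - 1)) = m ^ e * (e * 4 ^ e * (η / m)) := by
      have : m ^ e = m ^ (e - 1) * m := by rw [← pow_succ]; congr 1; omega
      rw [this]; field_simp
    rw [mul_add, ← h6, ← h7]
    linarith
  have hmain' := le_of_mul_le_mul_left hmain (pow_pos hm0 e)
  have hηm : η / m ≤ 24 * δ / P ^ 3 := by
    calc η / m ≤ η / (P / 2) := by gcongr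
      _ = 24 * δ / P ^ 3 := by rw [hηdef]; field_simp; ring
  have hsmall : δ + e * 4 ^ e * (η / m) ≤ P / 2 ^ (r + 1) := by
    calc δ + e * 4 ^ e * (η / m) ≤ δ / P ^ 3 + e * 4 ^ e * (24 * δ / P ^ 3) := by
          gcongr
          exact le_div_self hδ (by positivity) (pow_le_one₀ hP0.le hP1)
      _ = δ * ((1 + 24 * e * 4 ^ e) * 2 ^ (r + 1)) / (P ^ 3 * 2 ^ (r + 1)) := by field_simp
      _ ≤ P ^ 4 / (P ^ 3 * 2 ^ (r + 1)) := by gcongr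
      _ = P / 2 ^ (r + 1) := by field_simp
  have hlow : P / 2 ^ (r + 1) ≤ 4 ^ e * m ^ e := by
    have : P / 2 ^ r = 2 * (P / 2 ^ (r + 1)) := by rw [pow_succ]; field_simp
    linarith
  by_contra hcon
  push Not at hcon
  have h2 : 4 ^ e * m ^ e < 4 ^ e * (p / 16) ^ e := by
    gcongr
  have h3 : (4 : ℝ) ^ e * (p / 16) ^ e = P / 4 ^ e := by
    rw [← mul_pow, hP, ← div_pow]; congr 1; ring
  have h4 : P / 4 ^ e ≤ P / 2 ^ (r + 1) := by
    have h5 : r + 1 ≤ 2 * e := by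
      rw [he, two_mul_card_pairs]
      calc r + 1 ≤ r * 2 := by omega
        _ ≤ r * (r - 1) := Nat.mul_le_mul_left r (by omega)
    have h6 : (2 : ℝ) ^ (r + 1) ≤ 4 ^ e := by
      calc (2 : ℝ) ^ (r + 1) ≤ 2 ^ (2 * e) := pow_le_pow_right₀ (by norm_num) h5
        _ = 4 ^ e := by rw [pow_mul]; norm_num
    gcongr
  linarith

/-- The degrees are close in the mean to the constant `q = √(p m)`. Indeed, with `d` the degree,
the rank-one form of the edge density turns the clique count into
`∏ i, ∑ v, f i v * d v ^ (r - 1)`, which has to be proportional to `∏ i, ∑ v, f i v`. -/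
lemma sum_abs_degree_sub_le [Nonempty V] {s : ℕ} {p δ m q η : ℝ} (hw : 0 ≤ w)
    (hwn : Fintype.card V * w = 1) (h0 : ∀ x y, 0 ≤ W x y) (h1 : ∀ x y, W x y ≤ 1)
    (hm0 : 0 < m) (hm1 : m ≤ 1) (hη0 : 0 ≤ η)
    (hq0 : 0 < q) (hq1 : q ≤ 1) (hq : q ^ 2 = p * m)
    (hT : ∀ f : Fin (s + 2) → V → ℝ, (∀ i v, 0 ≤ f i v ∧ f i v ≤ w) →
      |cliqueForm W f - p ^ (pairs (s + 2)).card * ∏ i, ∑ v, f i v| ≤ δ)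
    (hη : ∀ f g : V → ℝ, (∀ v, 0 ≤ f v ∧ f v ≤ w) → (∀ v, 0 ≤ g v ∧ g v ≤ w) →
      |m * edgeForm W f g - (∑ v, f v * degree w W v) * ∑ v, g v * degree w W v| ≤ η) :
    m ^ (pairs (s + 2)).card * p ^ (pairs (s + 2)).card * ∑ v, w * |degree w W v - q|
      ≤ 4 * ((pairs (s + 2)).card * η + δ) := by
  set e := (pairs (s + 2)).card with he
  set d := degree w W with hd
  set η₂ := e * η + δ with hη₂
  have hd0 : ∀ v, 0 ≤ d v := degree_nonneg hw h0
  have hd1 : ∀ v, d v ≤ 1 := degree_le_one hw hwn h0 h1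
  have hw1 : ∑ _v : V, w = 1 := by rw [sum_const, card_univ, nsmul_eq_mul, hwn]
  set Q := q ^ (s + 1) with hQ
  have hQ0 : 0 < Q := pow_pos hq0 _
  have hqe : m ^ e * p ^ e = q ^ (2 * e) := by rw [pow_mul, hq, mul_pow, mul_comm]
  have hQr : m ^ e * p ^ e = Q ^ (s + 2) := by
    rw [hqe, he, two_mul_card_pairs, hQ, ← pow_mul]; congr 1; rw [mul_comm]; rfl
  have hall : ∀ f : Fin (s + 2) → V → ℝ, (∀ i v, 0 ≤ f i v ∧ f i v ≤ w) →
      |Q ^ (s + 2) * ∏ i, ∑ v, f i v - ∏ i, ∑ v, f i v * d v ^ (s + 1)| ≤ η₂ := by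
    intro f hf
    have htel := abs_patternForm_sub_le (L := 1) h0 h1 hw1.le (fun v => ⟨hd0 v, hd1 v⟩) hm0.le
      zero_le_one hη0 (fun f g hf hg => by simpa using hη f g hf hg) (pairs (s + 2)) subset_rfl
      f hf
    have hform : patternForm W (pairs (s + 2)) f = cliqueForm W f := rfl
    simp only [incidence_pairs, hform, one_pow, one_mul, mul_one, ← he] at htel
    have hgeom : ∑ k ∈ range e, m ^ k ≤ e := by
      calc ∑ k ∈ range e, m ^ k ≤ ∑ k ∈ range e, (1 : ℝ) :=
            sum_le_sum fun k _ => pow_le_one₀ hm0.le hm1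
        _ = e := by simp
    have h2 := mul_le_mul_of_nonneg_left hgeom hη0
    have h3 : |m ^ e * (cliqueForm W f - p ^ e * ∏ i, ∑ v, f i v)| ≤ δ := by
      rw [abs_mul, abs_of_nonneg (pow_nonneg hm0.le e)]
      exact (mul_le_of_le_one_left (abs_nonneg _) (pow_le_one₀ hm0.le hm1)).trans (hT f hf)
    rw [← hQr]
    rw [abs_le] at htel h3 ⊢
    have h4 : (s + 2 - 1 : ℕ) = s + 1 := rfl
    rw [h4] at htel
    constructor <;> nlinarith
  set M := ∑ v, w * d v ^ (s + 1) with hM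
  have hM0 : 0 ≤ M := sum_nonneg fun v _ => mul_nonneg hw (pow_nonneg (hd0 v) _)
  have hMr : |Q ^ (s + 2) - M ^ (s + 2)| ≤ η₂ := by
    have := hall (fun _ _ => w) fun _ _ => ⟨hw, le_rfl⟩
    simpa only [hw1, prod_const, one_pow, mul_one, card_univ, Fintype.card_fin] using this
  have hdev : ∀ f : V → ℝ, (∀ v, 0 ≤ f v ∧ f v ≤ w) →
      |∑ v, f v * (Q ^ (s + 1) * (d v ^ (s + 1) - Q))| ≤ 2 * η₂ := by
    intro f hf
    set D := ∑ v, f v * d v ^ (s + 1) with hD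
    have hD0 : 0 ≤ D := sum_nonneg fun v _ => mul_nonneg (hf v).1 (pow_nonneg (hd0 v) _)
    have hDM : D ≤ M := sum_le_sum fun v _ =>
      mul_le_mul_of_nonneg_right (hf v).2 (pow_nonneg (hd0 v) _)
    have h2 := hall (Fin.cons f fun _ _ => w) (by
      intro i
      refine Fin.cases ?_ (fun i v => ?_) i
      · simpa using hf
      · simp [hw])
    simp only [Fin.prod_univ_succ (n := s + 1), Fin.cons_zero, Fin.cons_succ, hw1, prod_const, one_pow, mul_one, card_univ,
      Fintype.card_fin] at h2
    rw [← hM, ← hD] at h2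
    have h3 : |Q ^ (s + 1) - M ^ (s + 1)| * D ≤ η₂ :=
      (mul_le_mul_of_nonneg_left hDM (abs_nonneg _)).trans
        ((abs_pow_sub_pow_mul_le hQ0.le hM0 (s + 1)).trans hMr)
    have h4 : |(Q ^ (s + 1) - M ^ (s + 1)) * D| ≤ η₂ := by
      rwa [abs_mul, abs_of_nonneg hD0]
    have h5 : ∑ v, f v * (Q ^ (s + 1) * (d v ^ (s + 1) - Q))
        = (Q ^ (s + 1) - M ^ (s + 1)) * D - (Q ^ (s + 2) * ∑ v, f v - D * M ^ (s + 1)) := by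
      have : ∑ v, f v * (Q ^ (s + 1) * (d v ^ (s + 1) - Q))
          = Q ^ (s + 1) * D - Q ^ (s + 2) * ∑ v, f v := by
        rw [hD, mul_sum, mul_sum, ← sum_sub_distrib]
        exact sum_congr rfl fun v _ => by ring
      rw [this]; ring
    rw [h5]
    rw [abs_le] at h2 h4 ⊢
    constructor <;> linarith
  have hL1 := sum_mul_abs_le_of_weights hw _ hdev
  have hfinal : m ^ e * p ^ e * ∑ v, w * |d v - q|
      ≤ q * ∑ v, w * |Q ^ (s + 1) * (d v ^ (s + 1) - Q)| := by
    rw [mul_sum, mul_sum]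
    refine sum_le_sum fun v _ => ?_
    have h2 := pow_mul_abs_sub_le (hd0 v) hq0.le s
    rw [← hQ] at h2
    rw [abs_mul, abs_of_pos (pow_pos hQ0 _), hQr]
    have h3 : Q ^ (s + 2) = Q ^ (s + 1) * (q * q ^ s) := by
      rw [pow_succ Q (s + 1)]; congr 1; rw [hQ]; ring
    calc Q ^ (s + 2) * (w * |d v - q|) = q * (w * (Q ^ (s + 1) * (q ^ s * |d v - q|))) := by
          rw [h3]; ring
      _ ≤ q * (w * (Q ^ (s + 1) * |d v ^ (s + 1) - Q|)) := by gcongr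
  calc _ ≤ q * ∑ v, w * |Q ^ (s + 1) * (d v ^ (s + 1) - Q)| := hfinal
    _ ≤ 1 * ∑ v, w * |Q ^ (s + 1) * (d v ^ (s + 1) - Q)| :=
        mul_le_mul_of_nonneg_right hq1 (sum_nonneg fun v _ => mul_nonneg hw (abs_nonneg _))
    _ ≤ 4 * η₂ := by linarith

/-- A kernel that is nearly of rank one and has nearly constant degrees is nearly constant. -/
lemma abs_edgeForm_sub_density_le {m q η Δ : ℝ} (hw : 0 ≤ w) (hwn : Fintype.card V * w = 1)
    (h0 : ∀ x y, 0 ≤ W x y) (hm : m = ∑ v, w * degree w W v) (hm0 : 0 < m)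
    (hΔ : ∑ v, w * |degree w W v - q| ≤ Δ)
    {f g : V → ℝ} (hf : ∀ v, 0 ≤ f v ∧ f v ≤ w) (hg : ∀ v, 0 ≤ g v ∧ g v ≤ w)
    (hη : |m * edgeForm W f g - (∑ v, f v * degree w W v) * ∑ v, g v * degree w W v| ≤ η) :
    |m - q| ≤ Δ ∧ |edgeForm W f g - m * ((∑ v, f v) * ∑ v, g v)| ≤ η / m + 4 * Δ := by
  set d := degree w W with hd
  have hd0 : ∀ v, 0 ≤ d v := degree_nonneg hw h0
  have hw1 : ∑ _v : V, w = 1 := by rw [sum_const, card_univ, nsmul_eq_mul, hwn]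
  have hdev : ∀ f : V → ℝ, (∀ v, 0 ≤ f v ∧ f v ≤ w) →
      |∑ v, f v * d v - q * ∑ v, f v| ≤ Δ := by
    intro f hf
    rw [mul_sum, ← sum_sub_distrib]
    refine ((abs_sum_le_sum_abs _ _).trans (sum_le_sum fun v _ => ?_)).trans hΔ
    rw [mul_comm q, ← mul_sub, abs_mul, abs_of_nonneg (hf v).1]
    exact mul_le_mul_of_nonneg_right (hf v).2 (abs_nonneg _)
  have hmq : |m - q| ≤ Δ := by
    have := hdev (fun _ => w) fun _ => ⟨hw, le_rfl⟩
    rwa [hw1, mul_one, ← hm] at this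
  have hΔ0 : 0 ≤ Δ := (abs_nonneg _).trans hmq
  have hdev' : ∀ f : V → ℝ, (∀ v, 0 ≤ f v ∧ f v ≤ w) →
      |∑ v, f v * d v - m * ∑ v, f v| ≤ 2 * Δ := by
    intro f hf
    have h2 := hdev f hf
    have h3 : |(m - q) * ∑ v, f v| ≤ Δ := by
      rw [abs_mul, abs_of_nonneg (sum_nonneg fun v _ => (hf v).1)]
      exact (mul_le_of_le_one_right (abs_nonneg _) (sum_weight_le_one hwn hf)).trans hmq
    rw [abs_le] at h2 h3 ⊢
    constructor <;> linarith
  refine ⟨hmq, ?_⟩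
  have hF := hdev' f hf
  have hG := hdev' g hg
  set F := ∑ v, f v with hFdef
  set G := ∑ v, g v with hGdef
  set DF := ∑ v, f v * d v
  set DG := ∑ v, g v * d v with hDG
  have hF0 : 0 ≤ F := sum_nonneg fun v _ => (hf v).1
  have hF1 : F ≤ 1 := sum_weight_le_one hwn hf
  have hDG0 : 0 ≤ DG := sum_nonneg fun v _ => mul_nonneg (hg v).1 (hd0 v)
  have hDGm : DG ≤ m := by
    rw [hm]
    exact sum_le_sum fun v _ => mul_le_mul_of_nonneg_right (hg v).2 (hd0 v)
  have h2 : |(DF - m * F) * DG| ≤ 2 * Δ * m := by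
    rw [abs_mul, abs_of_nonneg hDG0]
    exact mul_le_mul hF hDGm hDG0 (by linarith)
  have h3 : |m * F * (DG - m * G)| ≤ m * (2 * Δ) := by
    rw [abs_mul, abs_of_nonneg (mul_nonneg hm0.le hF0)]
    exact mul_le_mul (mul_le_of_le_one_right hm0.le hF1) hG (abs_nonneg _) hm0.le
  have h4 : m * |edgeForm W f g - m * (F * G)| ≤ η + 4 * Δ * m := by
    rw [← abs_of_pos hm0, ← abs_mul, abs_of_pos hm0]
    have : m * (edgeForm W f g - m * (F * G)) = (m * edgeForm W f g - DF * DG)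
        + ((DF - m * F) * DG + m * F * (DG - m * G)) := by ring
    rw [this]
    rw [abs_le] at h2 h3 hη ⊢
    constructor <;> linarith
  have h5 : η / m + 4 * Δ = (η + 4 * Δ * m) / m := by field_simp
  rw [h5, le_div_iff₀ hm0]
  linarith

/-- If the clique form is within `δ` of its expected value for all weights bounded by `w = 1 / n`,
then the edge form is within a constant times `δ / p ^ (4 * e)` of its expected value, where `e` is
the number of edges of `K_r`. -/
theorem abs_edgeForm_sub_le [Nonempty V] (hr : 3 ≤ r) {p δ : ℝ} (hp : 0 < p) (hp1 : p ≤ 1)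
    (hw : 0 ≤ w) (hwn : Fintype.card V * w = 1) (h0 : ∀ x y, 0 ≤ W x y) (h1 : ∀ x y, W x y ≤ 1)
    (hδ : 0 ≤ δ)
    (hδp : δ * ((1 + 24 * (pairs r).card * 4 ^ (pairs r).card) * 2 ^ (r + 1))
      ≤ (p ^ (pairs r).card) ^ 4)
    (hT : ∀ f : Fin r → V → ℝ, (∀ i v, 0 ≤ f i v ∧ f i v ≤ w) →
      |cliqueForm W f - p ^ (pairs r).card * ∏ i, ∑ v, f i v| ≤ δ)
    {f g : V → ℝ} (hf : ∀ v, 0 ≤ f v ∧ f v ≤ w) (hg : ∀ v, 0 ≤ g v ∧ g v ≤ w) :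
    |edgeForm W f g - p * ((∑ v, f v) * ∑ v, g v)|
      ≤ (24 + 36 * 16 ^ (pairs r).card * (12 * (pairs r).card + 1))
        * (δ / (p ^ (pairs r).card) ^ 4) := by
  obtain ⟨s, rfl⟩ : ∃ s, r = s + 2 := ⟨r - 2, by omega⟩
  set e := (pairs (s + 2)).card with he
  set P := p ^ e with hP
  have hP0 : 0 < P := pow_pos hp e
  have hP1 : P ≤ 1 := pow_le_one₀ hp.le hp1
  have hδP : δ ≤ P / 2 := by
    have h2 : (2 : ℝ) ≤ (1 + 24 * e * 4 ^ e) * 2 ^ (s + 2 + 1) := by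
      have h3 : (1 : ℝ) ≤ 1 + 24 * e * 4 ^ e := by
        have : (0 : ℝ) ≤ 24 * e * 4 ^ e := by positivity
        linarith
      have h4 : (2 : ℝ) ≤ 2 ^ (s + 2 + 1) := le_self_pow₀ (by norm_num) (by omega)
      nlinarith
    have h5 : P ^ 4 ≤ P := pow_le_of_le_one hP0.le hP1 (by norm_num)
    have h6 := mul_le_mul_of_nonneg_left h2 hδ
    linarith
  obtain ⟨m, hm⟩ : ∃ m, m = ∑ v, w * degree w W v := ⟨_, rfl⟩
  have hmedge : m = edgeForm W (fun _ => w) fun _ => w := by rw [hm, edgeForm_const]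
  have hmP : P / 2 ≤ m := by
    have h2 := sub_le_coreDensity hw hwn h0 h1 hT
    have h3 := coreDensity_le_edgeForm (s := s) hw hwn h0 h1
    rw [← hmedge] at h3
    linarith
  have hm0 : 0 < m := by linarith
  have hm1 : m ≤ 1 := by
    rw [hm]
    exact sum_weight_le_one hwn fun v => ⟨mul_nonneg hw (degree_nonneg hw h0 v),
      mul_le_of_le_one_right hw (degree_le_one hw hwn h0 h1 v)⟩
  have hη : ∀ f g : V → ℝ, (∀ v, 0 ≤ f v ∧ f v ≤ w) → (∀ v, 0 ≤ g v ∧ g v ≤ w) →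
      |m * edgeForm W f g - (∑ v, f v * degree w W v) * ∑ v, g v * degree w W v|
        ≤ 12 * δ / P ^ 2 := fun f g hf hg => by
    rw [hm]
    exact abs_edgeForm_rank_one_le hw hwn h0 h1 hδ hP0 hδP hT hf hg
  have hmp : p / 16 ≤ m :=
    div_sixteen_le_density hr hp hw hwn h0 h1 hδ hT hm hmP hm1 hη hp1 hδp
  obtain ⟨q, hqdef⟩ : ∃ q, q = Real.sqrt (p * m) := ⟨_, rfl⟩
  have hq0 : 0 < q := by rw [hqdef]; exact Real.sqrt_pos.2 (mul_pos hp hm0)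
  have hq : q ^ 2 = p * m := by rw [hqdef]; exact Real.sq_sqrt (mul_pos hp hm0).le
  have hq1 : q ≤ 1 := by
    rw [hqdef, Real.sqrt_le_one]
    exact mul_le_one₀ hp1 hm0.le hm1
  have hL1 := sum_abs_degree_sub_le hw hwn h0 h1 hm0 hm1 (by positivity) hq0 hq1 hq hT hη
  rw [← he, ← hP] at hL1
  obtain ⟨Δ, hΔ⟩ : ∃ Δ, Δ = ∑ v, w * |degree w W v - q| := ⟨_, rfl⟩
  rw [← hΔ] at hL1
  have hΔ0 : 0 ≤ Δ := by
    rw [hΔ]; exact sum_nonneg fun v _ => mul_nonneg hw (abs_nonneg _)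
  have hΔle : Δ ≤ 4 * 16 ^ e * (12 * e + 1) * (δ / P ^ 4) := by
    have h2 : P ^ 2 / 16 ^ e ≤ m ^ e * P := by
      have : (p / 16) ^ e ≤ m ^ e := pow_le_pow_left₀ (by positivity) hmp e
      calc P ^ 2 / 16 ^ e = (p / 16) ^ e * P := by rw [div_pow, ← hP]; ring
        _ ≤ m ^ e * P := by gcongr
    have h3 : P ^ 2 / 16 ^ e * Δ ≤ 4 * ((12 * e + 1) * (δ / P ^ 2)) := by
      calc P ^ 2 / 16 ^ e * Δ ≤ m ^ e * P * Δ := by gcongr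
        _ ≤ 4 * (e * (12 * δ / P ^ 2) + δ) := hL1
        _ ≤ 4 * (e * (12 * δ / P ^ 2) + δ / P ^ 2) := by
            gcongr
            exact le_div_self hδ (by positivity) (pow_le_one₀ hP0.le hP1)
        _ = 4 * ((12 * e + 1) * (δ / P ^ 2)) := by ring
    have h4 : Δ = 16 ^ e / P ^ 2 * (P ^ 2 / 16 ^ e * Δ) := by field_simp
    calc Δ = 16 ^ e / P ^ 2 * (P ^ 2 / 16 ^ e * Δ) := h4
      _ ≤ 16 ^ e / P ^ 2 * (4 * ((12 * e + 1) * (δ / P ^ 2))) := by gcongr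
      _ = 4 * 16 ^ e * (12 * e + 1) * (δ / P ^ 4) := by field_simp
  obtain ⟨hmq, hedge⟩ := abs_edgeForm_sub_density_le hw hwn h0 hm hm0 hΔ.ge hf hg (hη f g hf hg)
  -- Since `q ^ 2 = p * m`, the difference `m - p` equals `(m - q) * (m + q) / m`.
  have hpm : |m - p| ≤ 5 * Δ := by
    have hq4 : q ≤ 4 * m := by nlinarith
    have h2 : m * (m - p) = (m - q) * (m + q) := by nlinarith
    have h3 : m * |m - p| ≤ m * (5 * Δ) := by
      rw [← abs_of_pos hm0, ← abs_mul, abs_of_pos hm0, h2, abs_mul,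
        abs_of_pos (by linarith : 0 < m + q)]
      nlinarith [abs_nonneg (m - q)]
    exact le_of_mul_le_mul_left h3 hm0
  have hηm : 12 * δ / P ^ 2 / m ≤ 24 * (δ / P ^ 4) := by
    calc 12 * δ / P ^ 2 / m ≤ 12 * δ / P ^ 2 / (P / 2) := by gcongr
      _ = 24 * (δ / P ^ 3) := by field_simp; ring
      _ ≤ 24 * (δ / P ^ 4) := by
          gcongr 24 * (δ / ?_)
          exact pow_le_pow_of_le_one hP0.le hP1 (by norm_num)
  set F := ∑ v, f v with hF
  set G := ∑ v, g v with hG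
  have hFG0 : 0 ≤ F * G := mul_nonneg (sum_nonneg fun v _ => (hf v).1)
    (sum_nonneg fun v _ => (hg v).1)
  have hFG1 : F * G ≤ 1 := mul_le_one₀ (sum_weight_le_one hwn hf)
    (sum_nonneg fun v _ => (hg v).1) (sum_weight_le_one hwn hg)
  have hlast : |(m - p) * (F * G)| ≤ 5 * Δ := by
    rw [abs_mul, abs_of_nonneg hFG0]
    exact (mul_le_of_le_one_right (abs_nonneg _) hFG1).trans hpm
  have hsum : |edgeForm W f g - p * (F * G)| ≤ 24 * (δ / P ^ 4) + 9 * Δ := by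
    rw [abs_le] at hedge hlast ⊢
    constructor <;> linarith
  calc _ ≤ 24 * (δ / P ^ 4) + 9 * Δ := hsum
    _ ≤ 24 * (δ / P ^ 4) + 9 * (4 * 16 ^ e * (12 * e + 1) * (δ / P ^ 4)) := by gcongr
    _ = _ := by ring

end Degree

/-! ### Graphs -/

lemma cliqueForm_two (W : V → V → ℝ) (f : V → ℝ) :
    cliqueForm W (fun _ : Fin 2 => f) = edgeForm W f f := by
  have h : (fun _ : Fin 2 => f)
      = (Fin.cons f (Fin.cons f Fin.elim0) : Fin (0 + 2) → V → ℝ) := by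
    funext i
    fin_cases i <;> rfl
  rw [h, cliqueForm_cons_cons, edgeForm]
  refine sum_congr rfl fun x _ => sum_congr rfl fun y _ => ?_
  simp [cliqueKernel, joinKernel, pairs]
  ring

lemma cliqueForm_smul (W : V → V → ℝ) (c : ℝ) (f : Fin r → V → ℝ) :
    cliqueForm W (fun i v => c * f i v) = c ^ r * cliqueForm W f := by
  rw [cliqueForm, cliqueForm, mul_sum]
  refine sum_congr rfl fun x _ => ?_
  rw [prod_mul_distrib, prod_const, card_univ, Fintype.card_fin, mul_assoc]

end DegreeRegularity

end HereditaryQuasirandom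

open HereditaryQuasirandom in
theorem theorem1 (r : ℕ) (hr : 3 ≤ r) :
    ∃ c : ℝ, 0 < c ∧ ∀ p ε : ℝ, 0 < p → p < 1 → 0 < ε → ε < 1 →
      ∃ N : ℕ, ∀ (V : Type*) [Fintype V] (G : SimpleGraph V), N ≤ Fintype.card V →
        HereditaryCliqueCount r p (c * p ^ (2 * r ^ 2) * ε) G →
          HereditaryCliqueCount 2 p ε G := by
  have hr0 : (0 : ℝ) < r := by exact_mod_cast (by omega : 0 < r)
  set e := (pairs r).card with he
  set A : ℝ := (1 + 24 * e * 4 ^ e) * 2 ^ (r + 1) with hA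
  set B : ℝ := 24 + 36 * 16 ^ e * (12 * e + 1) with hB
  have hA0 : 0 < A := by positivity
  have hB0 : 0 < B := by positivity
  set D : ℝ := (2 * r) ^ r * 3 with hD
  have hD0 : 0 < D := by positivity
  refine ⟨1 / (D * (A + B)), by positivity, fun p ε hp0 hp1 hε0 hε1 => ?_⟩
  set δ : ℝ := 1 / (D * (A + B)) * p ^ (2 * r ^ 2) * ε with hδ
  have hδ0 : 0 < δ := by positivity
  refine ⟨⌈(r : ℝ) ^ 2 / δ⌉₊ + 1, fun V _ G hN hG => ?_⟩
  have hcard : 0 < Fintype.card V := by omega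
  have : Nonempty V := Fintype.card_pos_iff.1 hcard
  set n : ℝ := (Fintype.card V : ℝ) with hn
  have hn0 : 0 < n := by rw [hn]; exact_mod_cast hcard
  have hNn : (r : ℝ) ^ 2 / δ ≤ n :=
    (Nat.le_ceil _).trans (by rw [hn]; exact_mod_cast (by omega : ⌈(r : ℝ) ^ 2 / δ⌉₊ ≤ _))
  have hwn : n * n⁻¹ = 1 := mul_inv_cancel₀ hn0.ne'
  set P := p ^ e with hP
  have hP0 : 0 < P := pow_pos hp0 e
  have hT : ∀ f : Fin r → V → ℝ, (∀ i v, 0 ≤ f i v ∧ f i v ≤ n⁻¹) →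
      |cliqueForm (adjKernel G) f - P * ∏ i, ∑ v, f i v| ≤ D * δ := by
    intro f hf
    have h := abs_cliqueForm_sub_le (by omega) hp0 hp1 hδ0 G hNn hG (fun i v => n * f i v)
      fun i v => ⟨mul_nonneg hn0.le (hf i v).1, by
        rw [← hwn]; exact mul_le_mul_of_nonneg_left (hf i v).2 hn0.le⟩
    rw [cliqueForm_smul] at h
    simp only [← mul_sum, prod_mul_distrib, prod_const, card_univ, Fintype.card_fin] at h
    rw [← hn, ← he, ← hP] at h
    have h2 : n ^ r * |cliqueForm (adjKernel G) f - P * ∏ i, ∑ v, f i v| ≤ n ^ r * (D * δ) := by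
      rw [← abs_of_pos (pow_pos hn0 r), ← abs_mul, abs_of_pos (pow_pos hn0 r)]
      calc _ = |n ^ r * cliqueForm (adjKernel G) f - P * (n ^ r * ∏ i, ∑ v, f i v)| := by
            congr 1; ring
        _ ≤ _ := h
        _ = _ := by rw [hD]; ring
    exact le_of_mul_le_mul_left h2 (pow_pos hn0 r)
  have hpow : p ^ (2 * r ^ 2) ≤ P ^ 4 := by
    rw [hP, ← pow_mul]
    refine pow_le_pow_of_le_one hp0.le hp1.le ?_
    have h2 : 2 * e = r * (r - 1) := two_mul_card_pairs r
    have h3 : r * (r - 1) ≤ r * r := Nat.mul_le_mul_left r (by omega)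
    nlinarith
  have hDδ : (D * δ) * (A + B) ≤ P ^ 4 * ε := by
    have : (D * δ) * (A + B) = p ^ (2 * r ^ 2) * ε := by rw [hδ]; field_simp
    rw [this]; gcongr
  have hδA : D * δ * A ≤ P ^ 4 := by
    have h2 : 0 ≤ D * δ * B := by positivity
    have h3 : P ^ 4 * ε ≤ P ^ 4 := mul_le_of_le_one_right (by positivity) hε1.le
    linarith
  have hδB : B * (D * δ / P ^ 4) ≤ ε := by
    rw [← mul_div_assoc, div_le_iff₀ (by positivity)]
    have h2 : 0 ≤ D * δ * A := by positivity
    linarith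
  -- The edge bound is applied to the indicator of `S`, scaled by `1 / n`.
  intro S
  rw [ncard_edgeSet_completeGraph, labelledCopiesIn_completeGraph, Fintype.card_fin, card_pairs,
    Nat.choose_self, pow_one, cliqueForm_two]
  have hind : ∀ v, 0 ≤ n⁻¹ * (S : Set V).indicator 1 v ∧
      n⁻¹ * (S : Set V).indicator 1 v ≤ n⁻¹ := fun v => by
    have : 0 ≤ n⁻¹ := by positivity
    by_cases hv : v ∈ S <;> simp [hv, this]
  have h := (abs_edgeForm_sub_le hr hp0 hp1.le (inv_nonneg.2 hn0.le) hwn (adjKernel_nonneg G)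
    (adjKernel_le_one G) (by positivity) hδA hT hind hind).trans hδB
  have hcardS : ∑ v, (S : Set V).indicator (1 : V → ℝ) v = S.card := by
    classical
    simp [Set.indicator_apply]
  rw [← cliqueForm_two, cliqueForm_smul (f := fun _ : Fin 2 => (S : Set V).indicator 1),
    cliqueForm_two, ← mul_sum, hcardS] at h
  have h2 : ∀ x : ℝ, |n⁻¹ ^ 2 * x| ≤ ε → |x| ≤ ε * n ^ 2 := by
    intro x hx
    rw [abs_mul, abs_of_pos (by positivity), inv_pow, inv_mul_le_iff₀ (by positivity)] at hx
    linarith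
  refine h2 _ (le_of_eq_of_le ?_ h)
  congr 1
  ring
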